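/- **Conventions.** An étale groupoid is a second countable locally compact Hausdorff topological groupoid $\mathcal G$ whose range map $r:\mathcal G\to\mathcal G^{(0)}$ is a local homeomorphism; $s$ is the source map. $\mathcal G^{(n)}$ is the space of composable strings of $n$ elements ($\mathcal G^{(0)}$ is the unit space, $\mathcal G^{(n)}\subset\mathcal G^n$ for $n\ge1$). For an abelian group $A$ with the discrete topology, $C_c(X,A)$ is the group of compactly supported continuous functions $X\to A$. For a local homeomorphism $\varphi$ put $\varphi_*(f)(y)=\sum_{\varphi(x)=y}f(x)$. The complex $\mathcal C(\mathcal G,A)$ consists of the groups $C_c(\mathcal G^{(n)},A)$ with $\partial_n=\sum_{i=0}^n(-1)^i d_{i*}$, where $d_i:\mathcal G^{(n)}\to\mathcal G^{(n-1)}$ are the face maps of the nerve ($d_0=s$, $d_1=r$ for $n=1$). Let $\pi:X\to X'$ be a continuous proper surjection of locally compact metric spaces, and let $d_H$ be the Hausdorff metric. $\pi$ is *regular* if for all $x'\in X'$ and $\varepsilon>0$ there is an open neighbourhood $U'$ of $x'$ such that each $y'\in U'$ satisfies $d_H(\pi^{-1}(x'),\pi^{-1}(y'))<\varepsilon$ or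 $\operatorname{diam}\pi^{-1}(y')<\varepsilon$. Put $X'_\pi=\{x'\in X':\#\pi^{-1}(x')>1\}$ with the metric $d'_\pi(x',y')=d_H(\pi^{-1}(x'),\pi^{-1}(y'))$, and $X_\pi=\pi^{-1}(X'_\pi)$ with the metric $d(x,y)+d'_\pi(\pi(x),\pi(y))$. If $\pi$ is regular and $X,X'$ are totally disconnected, the *reduction map* $C_c(X,A)\to C_c(X_\pi,A)/C_c(X'_\pi,A)$, where $C_c(X'_\pi,A)$ is embedded by pull-back along $\pi$, sends $f$ to the class of $f_{K'}$ for every sufficiently large compact open $K'\subset X'_\pi$; here $f_{K'}=f$ on $\pi^{-1}(K')$ and $f_{K'}=0$ elsewhere on $X_\pi$. **Setting.** Let $\mathcal G,\mathcal G'$ be totally disconnected étale groupoids with fixed metrics inducing their topologies, and let $\pi:\mathcal G\to\mathcal G'$ be a continuous, proper, surjective groupoid homomorphism which maps $r^{-1}(x)$ bijectively onto $r^{-1}(\pi(x))$ for every $x\in\mathcal G^{(0)}$. Suppose that $\pi$ is regular. Let $\pi^{(n)}:\mathcal G^{(n)}\to\mathcal G'^{(n)}$ be the induced maps, with the restricted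 metric on $\mathcal G^{(0)}$ and the $\ell^1$-metric on $\mathcal G^{(n)}$, $n\ge1$. Let $A$ be a discrete abelian group. **Proposition.** The subgroupoids $\mathcal G_\pi\subset\mathcal G$ and $\mathcal G'_\pi\subset\mathcal G'$, with the metrics above, are étale groupoids; the restriction $\pi:\mathcal G_\pi\to\mathcal G'_\pi$ is again a continuous proper surjective homomorphism that is bijective from $r^{-1}(x)$ to $r^{-1}(\pi(x))$ for each unit $x$; and the canonical maps $\mathcal G_\pi^{(n)}\to(\mathcal G^{(n)})_{\pi^{(n)}}$ and $(\mathcal G'_\pi)^{(n)}\to(\mathcal G'^{(n)})_{\pi^{(n)}}$ are homeomorphisms, by which these spaces are identified. Moreover: 1. For every $n\ge0$, the reduction map arising from $\pi^{(n)}$ is well defined and induces an isomorphism $$\Pi_n:\;C_c(\mathcal G^{(n)},A)/C_c(\mathcal G'^{(n)},A)\;\longrightarrow\;C_c(\mathcal G_\pi^{(n)},A)/C_c((\mathcal G'_\pi)^{(n)},A).$$ 2. The family $(\Pi_n)_n$ is an isomorphism of chain complexes $$\Pi_*:\;\mathcal C(\mathcal G,A)/\mathcal C(\mathcal G',A)\;\cong\;\mathcal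 C(\mathcal G_\pi,A)/\mathcal C(\mathcal G'_\pi,A),$$ between the last terms of the short exact sequences of chain complexes $$0\to\mathcal C(\mathcal G',A)\xrightarrow{\pi^*}\mathcal C(\mathcal G,A)\to\mathcal C(\mathcal G,A)/\mathcal C(\mathcal G',A)\to0,$$ $$0\to\mathcal C(\mathcal G'_\pi,A)\xrightarrow{\pi^*}\mathcal C(\mathcal G_\pi,A)\to\mathcal C(\mathcal G_\pi,A)/\mathcal C(\mathcal G'_\pi,A)\to0.$$ -/

import Mathlib

open Topology CategoryTheory
open scoped CompactlySupported

namespace EtaleFactor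

section CompactSupport

variable {X Y Z A : Type*} [TopologicalSpace X] [TopologicalSpace Y] [TopologicalSpace Z]
  [TopologicalSpace A] [AddCommGroup A]

theorem isLocalHomeomorph_of_locallyInjective {f : X → Y} (hc : Continuous f) (ho : IsOpenMap f)
    (hl : ∀ x, ∃ U : Set X, IsOpen U ∧ x ∈ U ∧ Set.InjOn f U) : IsLocalHomeomorph f := by
  rw [isLocalHomeomorph_iff_isOpenEmbedding_restrict]
  intro x
  obtain ⟨U, hU, hx, hi⟩ := hl x
  exact ⟨U, hU.mem_nhds hx, .of_continuous_injective_isOpenMap hc.continuousOn.domRestrict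
    (Set.injOn_iff_injective.mp hi) (ho.domRestrict hU)⟩

theorem finite_fiber_inter [T1Space Y] {φ : X → Y} (hφ : IsLocalHomeomorph φ) {K : Set X}
    (hK : IsCompact K) (y : Y) : (K ∩ φ ⁻¹' {y}).Finite := by
  have hc : IsCompact (K ∩ φ ⁻¹' {y}) :=
    hK.inter_right (isClosed_singleton.preimage hφ.continuous)
  choose U hU hx hi using hφ.isLocallyInjective
  obtain ⟨t, -, ht⟩ := hc.elim_nhds_subcover U fun x _ => (hU x).mem_nhds (hx x)
  have : K ∩ φ ⁻¹' {y} ⊆ ⋃ x ∈ t, (U x ∩ φ ⁻¹' {y}) := by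
    intro z hz
    obtain ⟨x, hxt, hzx⟩ := Set.mem_iUnion₂.mp (ht hz)
    exact Set.mem_iUnion₂.mpr ⟨x, hxt, hzx, hz.2⟩
  refine (t.finite_toSet.biUnion fun x _ => Set.Subsingleton.finite ?_).subset this
  intro a ha b hb
  exact hi x ha.1 hb.1 (ha.2.trans hb.2.symm)

theorem finite_fiber_support [T1Space Y] {φ : X → Y} (hφ : IsLocalHomeomorph φ) (f : C_c(X, A))
    (y : Y) : (φ ⁻¹' {y} ∩ Function.support f).Finite :=
  (finite_fiber_inter hφ f.hasCompactSupport y).subset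
    fun _ hx => ⟨subset_tsupport _ hx.2, hx.1⟩

theorem eventually_fiberSum_eq [T2Space X] [T2Space Y] {φ : X → Y} (hφ : IsLocalHomeomorph φ)
    (f : C_c(X, A)) (y₀ : Y) : ∃ (F : Finset X), (∀ x ∈ F, φ x = y₀) ∧
      ∀ᶠ y in 𝓝 y₀, (∑ᶠ x ∈ φ ⁻¹' {y}, f x) = ∑ x ∈ F, f (hφ.localInverseAt x y) := by
  classical
  have hK : IsCompact (tsupport f) := f.hasCompactSupport
  have hfin := finite_fiber_inter hφ hK y₀
  obtain ⟨U, hU, hd⟩ := hfin.t2_separation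
  refine ⟨hfin.toFinset, fun x hx => ?_, ?_⟩
  · exact ((hfin.mem_toFinset).mp hx).2
  set F := hfin.toFinset with hF
  have hFm : ∀ x, x ∈ F ↔ x ∈ tsupport f ∧ φ x = y₀ := fun x => hfin.mem_toFinset
  -- the open neighbourhoods on which the local inverses live
  let W : X → Set X := fun x => U x ∩ (hφ.localInverseAt x).target
  have hW : ∀ x, IsOpen (W x) := fun x => (hU x).2.inter (hφ.localInverseAt x).open_target
  have hxW : ∀ x, x ∈ W x := fun x => ⟨(hU x).1, hφ.self_mem_localInverseAt_target⟩
  have hL : IsCompact (tsupport f \ ⋃ x ∈ F, W x) :=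
    hK.diff (isOpen_biUnion fun x _ => hW x)
  have hL' : IsClosed (φ '' (tsupport f \ ⋃ x ∈ F, W x)) := (hL.image hφ.continuous).isClosed
  have hy : y₀ ∉ φ '' (tsupport f \ ⋃ x ∈ F, W x) := by
    rintro ⟨x, ⟨hx, hx'⟩, hxy⟩
    exact hx' (Set.mem_iUnion₂.mpr ⟨x, (hFm x).mpr ⟨hx, hxy⟩, hxW x⟩)
  have h1 : ∀ᶠ y in 𝓝 y₀, y ∉ φ '' (tsupport f \ ⋃ x ∈ F, W x) := hL'.isOpen_compl.mem_nhds hy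
  have h2 : ∀ᶠ y in 𝓝 y₀, ∀ x ∈ F, y ∈ φ '' W x := by
    rw [Filter.eventually_all_finset]
    intro x hx
    have := hφ.isOpenMap _ (hW x)
    exact this.mem_nhds ⟨x, hxW x, ((hFm x).mp hx).2⟩
  filter_upwards [h1, h2] with y hy1 hy2
  have hloc : ∀ x ∈ F, hφ.localInverseAt x y ∈ W x ∧ φ (hφ.localInverseAt x y) = y := by
    intro x hx
    obtain ⟨z, hz, rfl⟩ := hy2 x hx
    have hz2 : hφ.localInverseAt x (φ z) = z := by
      have := (hφ.localInverseAt x).right_inv hz.2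
      rwa [hφ.localInverseAt_symm] at this
    rw [hz2]
    exact ⟨hz, rfl⟩
  have hinj : Set.InjOn (fun x => hφ.localInverseAt x y) (F : Set X) := by
    intro a ha b hb hab
    by_contra hne
    have ha' : a ∈ tsupport f ∩ φ ⁻¹' {y₀} := (hFm a).mp ha
    have hb' : b ∈ tsupport f ∩ φ ⁻¹' {y₀} := (hFm b).mp hb
    have := hd ha' hb' hne
    refine Set.disjoint_left.mp this (hloc a ha).1.1 ?_
    have h := (hloc b hb).1.1
    simp only at hab
    rwa [← hab] at h
  rw [← Finset.sum_image (f := fun x => f x) hinj]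
  refine finsum_mem_eq_sum_of_inter_support_eq _ ?_
  ext z
  simp only [Set.mem_inter_iff, Set.mem_preimage, Set.mem_singleton_iff, Finset.coe_image,
    Set.mem_image]
  refine and_congr_left fun hz => ⟨fun hzy => ?_, ?_⟩
  · by_contra hcon
    refine hy1 ⟨z, ⟨subset_tsupport _ hz, fun hz' => ?_⟩, hzy⟩
    obtain ⟨x, hx, hzx⟩ := Set.mem_iUnion₂.mp hz'
    refine hcon ⟨x, hx, ?_⟩
    have := (hφ.localInverseAt x).right_inv hzx.2
    rwa [hφ.localInverseAt_symm, hzy] at this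
  · rintro ⟨x, hx, rfl⟩
    exact (hloc x hx).2

/-- The push-forward `φ_* f (y) = ∑_{φ x = y} f x` of compactly supported continuous functions
along a local homeomorphism. -/
noncomputable def push [T2Space X] [T2Space Y] [IsTopologicalAddGroup A] (φ : X → Y)
    (hφ : IsLocalHomeomorph φ) : C_c(X, A) →+ C_c(Y, A) where
  toFun f :=
    { toFun := fun y => ∑ᶠ x ∈ φ ⁻¹' {y}, f x
      continuous_toFun := by
        rw [continuous_iff_continuousAt]
        intro y₀
        obtain ⟨F, hF, hev⟩ := eventually_fiberSum_eq hφ f y₀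
        refine ContinuousAt.congr ?_ (hev.mono fun _ h => h.symm)
        refine tendsto_finsetSum _ fun x hx => ?_
        have hx' : φ x = y₀ := hF x hx
        have : ContinuousAt (hφ.localInverseAt x) y₀ :=
          (hφ.localInverseAt x).continuousAt (hx' ▸ hφ.apply_self_mem_localInverseAt_source)
        exact f.continuous.continuousAt.comp this
      hasCompactSupport' := by
        refine HasCompactSupport.intro (K := φ '' tsupport f)
          (IsCompact.image f.hasCompactSupport hφ.continuous) fun y hy => ?_
        refine finsum_mem_eq_zero_of_forall_eq_zero fun x hx => ?_
        by_contra h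
        exact hy ⟨x, subset_tsupport _ h, hx⟩ }
  map_zero' := by
    ext y
    exact finsum_mem_eq_zero_of_forall_eq_zero fun x _ => rfl
  map_add' f g := by
    ext y
    exact finsum_mem_add_distrib' (finite_fiber_support hφ f y) (finite_fiber_support hφ g y)

theorem push_apply [T2Space X] [T2Space Y] [IsTopologicalAddGroup A] {φ : X → Y}
    (hφ : IsLocalHomeomorph φ) (f : C_c(X, A)) (y : Y) :
    push φ hφ f y = ∑ᶠ x ∈ φ ⁻¹' {y}, f x := rfl

theorem push_push [T2Space X] [T2Space Y] [T2Space Z] [IsTopologicalAddGroup A] {φ : X → Y}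
    {ψ : Y → Z} {χ : X → Z} (hφ : IsLocalHomeomorph φ) (hψ : IsLocalHomeomorph ψ)
    (hχ : IsLocalHomeomorph χ) (h : ∀ x, ψ (φ x) = χ x) (f : C_c(X, A)) :
    push ψ hψ (push φ hφ f) = push χ hχ f := by
  classical
  ext z
  have hfin := finite_fiber_support hχ f z
  have hS : ∀ x, x ∈ hfin.toFinset ↔ χ x = z ∧ f x ≠ 0 := fun x => hfin.mem_toFinset
  have hin : ∀ y, ψ y = z → push φ hφ f y = ∑ x ∈ hfin.toFinset with φ x = y, f x := by
    intro y hy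
    refine finsum_mem_eq_sum_of_inter_support_eq _ ?_
    ext x
    simp only [Set.mem_inter_iff, Set.mem_preimage, Set.mem_singleton_iff, Function.mem_support,
      Finset.coe_filter, hS, Set.mem_ofPred_eq]
    constructor
    · rintro ⟨h1, h2⟩
      exact ⟨⟨⟨by rw [← h x, h1, hy], h2⟩, h1⟩, h2⟩
    · rintro ⟨⟨⟨_, h2⟩, h1⟩, -⟩
      exact ⟨h1, h2⟩
  have hL : push ψ hψ (push φ hφ f) z = ∑ y ∈ hfin.toFinset.image φ, push φ hφ f y := by
    refine finsum_mem_eq_sum_of_subset _ ?_ ?_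
    · rintro y ⟨hy, hy'⟩
      have hy0 : push φ hφ f y ≠ 0 := hy'
      rw [hin y hy] at hy0
      obtain ⟨x, hx, -⟩ := Finset.exists_ne_zero_of_sum_ne_zero hy0
      rw [Finset.mem_filter] at hx
      exact Finset.mem_coe.mpr (Finset.mem_image.mpr ⟨x, hx.1, hx.2⟩)
    · intro y hy
      obtain ⟨x, hx, rfl⟩ := Finset.mem_image.mp (Finset.mem_coe.mp hy)
      exact (h x).trans ((hS x).mp hx).1
  have hR : push χ hχ f z = ∑ x ∈ hfin.toFinset, f x := by
    refine finsum_mem_eq_sum_of_inter_support_eq _ ?_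
    ext x
    simp
  rw [hL, hR, ← Finset.sum_fiberwise_of_maps_to (g := φ) (t := hfin.toFinset.image φ)
    fun x hx => Finset.mem_image_of_mem _ hx]
  refine Finset.sum_congr rfl fun y hy => ?_
  obtain ⟨x, hx, rfl⟩ := Finset.mem_image.mp hy
  exact hin _ ((h x).trans ((hS x).mp hx).1)

/-- The pull-back `f ↦ f ∘ p` of compactly supported continuous functions along a continuous
proper map. -/
noncomputable def pull [IsTopologicalAddGroup A] (p : X → Y) (hp : IsProperMap p) :
    C_c(Y, A) →+ C_c(X, A) where
  toFun f :=
    { toFun := fun x => f (p x)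
      continuous_toFun := f.continuous.comp hp.continuous
      hasCompactSupport' := by
        have hK : IsCompact (p ⁻¹' tsupport f) := hp.isCompact_preimage f.hasCompactSupport
        refine HasCompactSupport.intro' hK ((isClosed_tsupport f).preimage hp.continuous)
          fun x hx => ?_
        exact image_eq_zero_of_notMem_tsupport hx }
  map_zero' := rfl
  map_add' _ _ := rfl

theorem push_pull {X' Y' : Type*} [TopologicalSpace X'] [TopologicalSpace Y'] [T2Space X]
    [T2Space Y] [T2Space X'] [T2Space Y'] [IsTopologicalAddGroup A] {φ : X → Y} {φ' : X' → Y'}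
    (hφ : IsLocalHomeomorph φ) (hφ' : IsLocalHomeomorph φ') {p : X → X'} {q : Y → Y'}
    (hp : IsProperMap p) (hq : IsProperMap q)  (hb : ∀ y, Set.BijOn p (φ ⁻¹' {y}) (φ' ⁻¹' {q y})) (f : C_c(X', A)) :
    push φ hφ (pull p hp f) = pull q hq (push φ' hφ' f) := by
  ext y
  exact finsum_mem_eq_of_bijOn p (hb y) fun x _ => rfl

end CompactSupport
/-! ### Étale groupoids and their nerves -/

section Groupoid

/-- A groupoid in the arrows-only formulation: `r` and `s` are the range and the source map, with
values in the units, and `mul g h` is defined exactly when `s g = r h`. -/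
class GroupoidStr (G : Type*) where
  /-- the range map `g ↦ g g⁻¹` -/
  r : G → G
  /-- the source map `g ↦ g⁻¹ g` -/
  s : G → G
  /-- the inverse map -/
  inv : G → G
  /-- the product of composable pairs -/
  mul : (g h : G) → s g = r h → G
  r_mul : ∀ (g h : G) (e : s g = r h), r (mul g h e) = r g
  s_mul : ∀ (g h : G) (e : s g = r h), s (mul g h e) = s h
  mul_assoc : ∀ (g h k : G) (e₁ : s g = r h) (e₂ : s h = r k),
    mul (mul g h e₁) k ((s_mul g h e₁).trans e₂) = mul g (mul h k e₂) (e₁.trans (r_mul h k e₂).symm)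
  s_r : ∀ g : G, s (r g) = r g
  r_s : ∀ g : G, r (s g) = s g
  r_mul_self : ∀ g : G, mul (r g) g (s_r g) = g
  mul_s_self : ∀ g : G, mul g (s g) (r_s g).symm = g
  r_inv : ∀ g : G, r (inv g) = s g
  s_inv : ∀ g : G, s (inv g) = r g
  mul_inv : ∀ g : G, mul g (inv g) (r_inv g).symm = r g
  inv_mul : ∀ g : G, mul (inv g) g (s_inv g) = s g

open GroupoidStr

variable {G : Type*} [GroupoidStr G]

theorem r_r (g : G) : r (r g) = r g := by
  have := r_s (r g)
  rwa [s_r] at this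

theorem s_s (g : G) : s (s g) = s g := by
  have := s_r (s g)
  rwa [r_s] at this

theorem mul_congr {g g' h h' : G} (hg : g = g') (hh : h = h') (e : s g = r h) :
    mul g h e = mul g' h' (by rw [← hg, ← hh]; exact e) := by
  subst hg hh; rfl

theorem inv_unique {g h : G} (e : s g = r h) (he : mul g h e = r g) : h = inv g := by
  have h1 := mul_assoc (inv g) g h (s_inv g) e
  rw [mul_congr (inv_mul g) rfl, mul_congr rfl he] at h1
  rw [← r_mul_self h, ← mul_s_self (inv g), mul_congr e.symm rfl, h1]
  exact mul_congr rfl (s_inv g).symm _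

theorem inv_inv (g : G) : inv (inv g) = g :=
  (inv_unique (s_inv g) ((inv_mul g).trans (r_inv g).symm)).symm

variable (G) in
/-- The unit space `G⁽⁰⁾`, a subset of `G`. -/
abbrev UnitSpace : Type _ := {x : G // r x = x}

variable (G) in
/-- The space `G⁽ⁿ⁾` of composable strings of `n` elements; `G⁽⁰⁾` is the unit space. -/
def Str : ℕ → Type _
  | 0 => UnitSpace G
  | n + 1 => {g : Fin (n + 1) → G // ∀ k : Fin n, s (g k.castSucc) = r (g k.succ)}

/-- The unit given by an element of `G⁽⁰⁾`. -/
def Str.pt (x : Str G 0) : UnitSpace G := x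

/-- The entries of a composable string. -/
def Str.arr {n : ℕ} (g : Str G (n + 1)) : Fin (n + 1) → G := g.1

/-- A composable string from its entries. -/
def Str.mk {n : ℕ} (g : Fin (n + 1) → G) (h : ∀ k : Fin n, s (g k.castSucc) = r (g k.succ)) :
    Str G (n + 1) := ⟨g, h⟩

theorem Str.comp {n : ℕ} (g : Str G (n + 1)) (k : Fin n) :
    s (g.arr k.castSucc) = r (g.arr k.succ) := g.2 k

@[simp]
theorem Str.arr_mk {n : ℕ} (g : Fin (n + 1) → G)
    (h : ∀ k : Fin n, s (g k.castSucc) = r (g k.succ)) : (Str.mk g h).arr = g := rfl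

theorem Str.ext {n : ℕ} {g h : Str G (n + 1)} (e : ∀ k, g.arr k = h.arr k) : g = h :=
  Subtype.ext (funext e)

/-- The range map, as a map to the unit space. -/
def rangeUnit (g : G) : UnitSpace G := ⟨r g, r_r g⟩

/-- The source map, as a map to the unit space. -/
def sourceUnit (g : G) : UnitSpace G := ⟨s g, r_s g⟩

/-- The face maps `dᵢ : G⁽ⁿ⁺¹⁾ → G⁽ⁿ⁾`. For `n = 0`, `d₀` is the source map and `d₁` the range map.
For `n ≥ 1`, `d₀` deletes the first entry, `d_{n+1}` deletes the last one, and the other `dᵢ`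
multiply the `i`-th entry by the next one (entries being counted from `1`). -/
def face : (n : ℕ) → Fin (n + 2) → Str G (n + 1) → Str G n
  | 0, i, g => if i = 0 then sourceUnit (g.arr 0) else rangeUnit (g.arr 0)
  | n + 1, i, g => Str.mk (fun k =>
      if (k : ℕ) + 1 < i then g.arr k.castSucc
      else if (k : ℕ) + 1 = i then mul (g.arr k.castSucc) (g.arr k.succ) (g.comp k)
      else g.arr k.succ) <| by
    intro k
    have h0 := g.comp k.castSucc
    have h1 := g.comp k.succ
    simp only [Fin.val_castSucc, Fin.val_succ, Fin.succ_castSucc] at h0 h1 ⊢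
    split_ifs <;> first | omega | simp only [r_mul, s_mul, h0, h1]

theorem face_zero_zero (g : Str G 1) : (face 0 0 g).pt = sourceUnit (g.arr 0) := rfl

theorem face_zero_one (g : Str G 1) : (face 0 1 g).pt = rangeUnit (g.arr 0) := rfl

theorem face_arr (n : ℕ) (i : Fin (n + 3)) (g : Str G (n + 1 + 1)) (k : Fin (n + 1)) :
    (face (n + 1) i g).arr k = if (k : ℕ) + 1 < i then g.arr k.castSucc
      else if (k : ℕ) + 1 = i then mul (g.arr k.castSucc) (g.arr k.succ) (g.comp k)
      else g.arr k.succ := rfl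

theorem face_arr_of_lt {n : ℕ} {i : Fin (n + 3)} (g : Str G (n + 1 + 1)) {k : Fin (n + 1)}
    (h : (k : ℕ) + 1 < i) : (face (n + 1) i g).arr k = g.arr k.castSucc := by
  rw [face_arr, if_pos h]

theorem face_arr_of_eq {n : ℕ} {i : Fin (n + 3)} (g : Str G (n + 1 + 1)) {k : Fin (n + 1)}
    (h : (k : ℕ) + 1 = i) :
    (face (n + 1) i g).arr k = mul (g.arr k.castSucc) (g.arr k.succ) (g.comp k) := by
  rw [face_arr, if_neg (by omega), if_pos h]

theorem face_arr_mul {n : ℕ} {i : Fin (n + 3)} (g : Str G (n + 1 + 1)) {k : Fin (n + 1)}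
    (h : (k : ℕ) + 1 = i) {a b : G} (ha : g.arr k.castSucc = a) (hb : g.arr k.succ = b) :
    (face (n + 1) i g).arr k = mul a b (by rw [← ha, ← hb]; exact g.comp k) := by
  rw [face_arr_of_eq g h, mul_congr ha hb]

theorem face_arr_of_gt {n : ℕ} {i : Fin (n + 3)} (g : Str G (n + 1 + 1)) {k : Fin (n + 1)}
    (h : (i : ℕ) < (k : ℕ) + 1) : (face (n + 1) i g).arr k = g.arr k.succ := by
  rw [face_arr, if_neg (by omega), if_neg (by omega)]

theorem face_face (n : ℕ) (i j : Fin (n + 2)) (hij : i ≤ j) (g : Str G (n + 1 + 1)) :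
    face n i (face (n + 1) j.succ g) = face n j (face (n + 1) i.castSucc g) := by
  rw [Fin.le_def] at hij
  cases n with
  | zero =>
    refine Subtype.ext ?_
    have h0 := g.comp 0
    fin_cases i <;> fin_cases j <;>
      simp [face, sourceUnit, rangeUnit, s_mul, r_mul] at hij h0 ⊢
    all_goals simp [h0]
  | succ n =>
    refine Str.ext fun k => ?_
    have hk1 : (k.castSucc : ℕ) = k := rfl
    have hk2 : (k.succ : ℕ) = k + 1 := by simp
    have hi : (i.castSucc : ℕ) = i := rfl
    have hj : (j.succ : ℕ) = j + 1 := by simp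
    rcases lt_trichotomy ((k : ℕ) + 1) i with h | h | h
    · rw [face_arr_of_lt _ h, face_arr_of_lt _ (by omega), face_arr_of_lt _ (by omega),
        face_arr_of_lt _ (by omega)]
    · rcases hij.eq_or_lt with h' | h'
      · rw [face_arr_mul (i := i) _ h (face_arr_of_lt g (by omega)) (face_arr_of_eq g (by omega)),
          face_arr_mul (i := j) _ (by omega) (face_arr_of_eq g (by omega))
            (face_arr_of_gt g (by omega))]
        exact (mul_assoc _ _ _ _ _).symm
      · rw [face_arr_mul (i := i) _ h (face_arr_of_lt g (by omega)) (face_arr_of_lt g (by omega)),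
          face_arr_of_lt (i := j) _ (by omega), face_arr_of_eq (i := i.castSucc) _ (by omega)]
        rfl
    · rw [face_arr_of_gt (i := i) _ h]
      rcases lt_trichotomy ((k : ℕ) + 1) j with h' | h' | h'
      · rw [face_arr_of_lt (i := j) _ h', face_arr_of_lt (i := j.succ) _ (by omega),
          face_arr_of_gt (i := i.castSucc) _ (by omega)]
        rfl
      · rw [face_arr_mul (i := j) _ h' (face_arr_of_gt g (by omega))
          (face_arr_of_gt g (by omega)), face_arr_of_eq (i := j.succ) _ (by omega)]
        rfl
      · rw [face_arr_of_gt (i := j) _ h', face_arr_of_gt (i := j.succ) _ (by omega),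
          face_arr_of_gt (i := i.castSucc) _ (by omega)]

instance instTopologicalSpaceStr [TopologicalSpace G] : (n : ℕ) → TopologicalSpace (Str G n)
  | 0 => inferInstanceAs (TopologicalSpace (UnitSpace G))
  | n + 1 => inferInstanceAs (TopologicalSpace
      {g : Fin (n + 1) → G // ∀ k : Fin n, s (g k.castSucc) = r (g k.succ)})

variable (G) in
/-- An étale groupoid: a second countable locally compact Hausdorff topological groupoid whose
range map `G → G⁽⁰⁾` is a local homeomorphism. -/
class IsEtale [TopologicalSpace G] : Prop where
  secondCountable : SecondCountableTopology G
  locallyCompact : LocallyCompactSpace G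
  hausdorff : T2Space G
  continuous_mul : Continuous fun p : {p : G × G // s p.1 = r p.2} => mul p.1.1 p.1.2 p.2
  continuous_inv : Continuous (inv : G → G)
  isLocalHomeomorph_range : IsLocalHomeomorph (rangeUnit : G → UnitSpace G)

/-- The range of the first entry. -/
def firstVertex : (n : ℕ) → Str G n → UnitSpace G
  | 0, x => x.pt
  | _ + 1, g => rangeUnit (g.arr 0)

/-- The source of the last entry. -/
def lastVertex : (n : ℕ) → Str G n → UnitSpace G
  | 0, x => x.pt
  | n + 1, g => sourceUnit (g.arr (Fin.last n))

theorem firstVertex_face : (n : ℕ) → (i : Fin (n + 2)) → i ≠ 0 → (g : Str G (n + 1)) →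
    firstVertex n (face n i g) = firstVertex (n + 1) g
  | 0, i, hi, g => if_neg hi
  | n + 1, i, hi, g => by
    refine Subtype.ext ?_
    have hi' : 1 ≤ (i : ℕ) := Nat.one_le_iff_ne_zero.mpr fun h => hi (Fin.ext h)
    change r ((face (n + 1) i g).arr 0) = r (g.arr 0)
    rcases lt_or_eq_of_le hi' with h | h
    · rw [face_arr_of_lt g (k := 0) (by simpa using h)]; rfl
    · rw [face_arr_of_eq g (k := 0) (by simpa using h), r_mul]; rfl

theorem lastVertex_face : (n : ℕ) → (i : Fin (n + 2)) → i ≠ Fin.last (n + 1) →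
    (g : Str G (n + 1)) → lastVertex n (face n i g) = lastVertex (n + 1) g
  | 0, i, hi, g => by
    have : i = 0 := by
      have := i.2
      have h : (i : ℕ) ≠ 1 := fun h => hi (Fin.ext h)
      exact Fin.ext (by change (i : ℕ) = 0; omega)
    subst this; rfl
  | n + 1, i, hi, g => by
    refine Subtype.ext ?_
    have hi' : (i : ℕ) < n + 2 := by
      have := i.2
      have h : (i : ℕ) ≠ n + 2 := fun h => hi (Fin.ext h)
      omega
    change s ((face (n + 1) i g).arr (Fin.last n)) = s (g.arr (Fin.last (n + 1)))
    rcases (Nat.le_of_lt_succ hi').lt_or_eq with h | h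
    · rw [face_arr_of_gt g (k := Fin.last n) (by simpa using h)]; rfl
    · rw [face_arr_of_eq g (k := Fin.last n) (by simp [h]), s_mul]; rfl

theorem firstVertex_face_zero (n : ℕ) (g : Str G (n + 1 + 1)) :
    firstVertex (n + 1) (face (n + 1) 0 g) = sourceUnit (g.arr 0) := by
  refine Subtype.ext ?_
  change r ((face (n + 1) 0 g).arr 0) = s (g.arr 0)
  rw [face_arr_of_gt g (k := 0) (Nat.succ_pos _)]
  exact (g.comp 0).symm

/-- Prepending an element to a composable string. -/
def consStr {n : ℕ} (a : G) (g : Str G (n + 1)) (h : s a = r (g.arr 0)) : Str G (n + 1 + 1) :=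
  Str.mk (Fin.cons a g.arr) fun k => by
    refine Fin.cases ?_ (fun k => ?_) k
    · exact h
    · exact g.comp k

theorem face_consStr {n : ℕ} (a : G) (g : Str G (n + 1)) (h : s a = r (g.arr 0)) :
    face (n + 1) 0 (consStr a g h) = g := by
  refine Str.ext fun k => ?_
  rw [face_arr_of_gt _ (Nat.succ_pos _)]
  rfl

theorem str_ext_cons {n : ℕ} {g h : Str G (n + 1 + 1)} (h0 : g.arr 0 = h.arr 0)
    (h1 : face (n + 1) 0 g = face (n + 1) 0 h) : g = h := by
  refine Str.ext fun k => ?_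
  refine Fin.cases h0 (fun k => ?_) k
  rw [← face_arr_of_gt g (i := 0) (k := k) (Nat.succ_pos _), h1,
    face_arr_of_gt h (i := 0) (k := k) (Nat.succ_pos _)]

/-- The string `(gₙ⁻¹, …, g₁⁻¹)`. -/
def revStr : (n : ℕ) → Str G n → Str G n
  | 0, x => x
  | n + 1, g => Str.mk (fun k => inv (g.arr k.rev)) fun k => by
    rw [s_inv, r_inv, Fin.rev_castSucc, Fin.rev_succ]
    exact (g.comp k.rev).symm

theorem revStr_arr (n : ℕ) (g : Str G (n + 1)) (k : Fin (n + 1)) :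
    (revStr (n + 1) g).arr k = inv (g.arr k.rev) := rfl

theorem revStr_revStr : (n : ℕ) → (g : Str G n) → revStr n (revStr n g) = g
  | 0, _ => rfl
  | n + 1, g => Str.ext fun k => by rw [revStr_arr, revStr_arr, inv_inv, Fin.rev_rev]

theorem firstVertex_revStr : (n : ℕ) → (g : Str G n) → firstVertex n (revStr n g) = lastVertex n g
  | 0, _ => rfl
  | n + 1, g => Subtype.ext (by
    change r (inv (g.arr (Fin.rev 0))) = s (g.arr (Fin.last n))
    rw [r_inv, Fin.rev_zero])

theorem lastVertex_revStr (n : ℕ) (g : Str G n) : lastVertex n (revStr n g) = firstVertex n g := by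
  rw [← firstVertex_revStr, revStr_revStr]

section Topology

variable [TopologicalSpace G]

theorem isEmbedding_arr (n : ℕ) : IsEmbedding (Str.arr : Str G (n + 1) → Fin (n + 1) → G) :=
  IsEmbedding.subtypeVal

theorem continuous_arr (n : ℕ) (k : Fin (n + 1)) :
    Continuous fun g : Str G (n + 1) => g.arr k :=
  (continuous_apply k).comp (isEmbedding_arr n).continuous

variable [IsEtale G]

theorem continuous_rangeUnit : Continuous (rangeUnit : G → UnitSpace G) :=
  IsEtale.isLocalHomeomorph_range.continuous

theorem continuous_r : Continuous (r : G → G) :=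
  continuous_subtype_val.comp continuous_rangeUnit

theorem continuous_sourceUnit : Continuous (sourceUnit : G → UnitSpace G) := by
  have : (sourceUnit : G → UnitSpace G) = rangeUnit ∘ inv := by
    funext g
    exact Subtype.ext (r_inv g).symm
  rw [this]
  exact continuous_rangeUnit.comp IsEtale.continuous_inv

theorem continuous_s : Continuous (s : G → G) :=
  continuous_subtype_val.comp continuous_sourceUnit

theorem isClosedEmbedding_arr (n : ℕ) :
    IsClosedEmbedding (Str.arr : Str G (n + 1) → Fin (n + 1) → G) := by
  have : T2Space G := IsEtale.hausdorff
  refine ⟨isEmbedding_arr n, ?_⟩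
  have : Set.range (Str.arr : Str G (n + 1) → Fin (n + 1) → G) =
      ⋂ k : Fin n, {g | s (g k.castSucc) = r (g k.succ)} := by
    ext g
    rw [Set.mem_iInter]
    exact ⟨fun ⟨h, e⟩ k => e ▸ h.comp k, fun h => ⟨Str.mk g h, rfl⟩⟩
  rw [this]
  exact isClosed_iInter fun k => isClosed_eq (continuous_s.comp (continuous_apply _))
    (continuous_r.comp (continuous_apply _))

instance instT2SpaceStr : (n : ℕ) → T2Space (Str G n)
  | 0 => by
    have : T2Space G := IsEtale.hausdorff
    exact inferInstanceAs (T2Space (UnitSpace G))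
  | n + 1 => by
    have : T2Space G := IsEtale.hausdorff
    exact (isEmbedding_arr n).t2Space

theorem continuous_face : (n : ℕ) → (i : Fin (n + 2)) → Continuous (face (G := G) n i)
  | 0, i => by
    by_cases h : i = 0
    · have : face (G := G) 0 i = fun g => sourceUnit (g.arr 0) := by
        funext g; exact if_pos h
      rw [this]
      exact continuous_sourceUnit.comp (continuous_arr 0 0)
    · have : face (G := G) 0 i = fun g => rangeUnit (g.arr 0) := by
        funext g; exact if_neg h
      rw [this]
      exact continuous_rangeUnit.comp (continuous_arr 0 0)
  | n + 1, i => by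
    rw [(isEmbedding_arr n).continuous_iff, continuous_pi_iff]
    intro k
    rcases lt_trichotomy ((k : ℕ) + 1) i with h | h | h
    · exact (continuous_arr (n + 1) k.castSucc).congr fun g => (face_arr_of_lt g h).symm
    · refine Continuous.congr ?_ fun g => (face_arr_of_eq g h).symm
      exact (IsEtale.continuous_mul (G := G)).comp (Continuous.subtype_mk
        ((continuous_arr (n + 1) k.castSucc).prodMk (continuous_arr (n + 1) k.succ))
        fun g => g.comp k)
    · exact (continuous_arr (n + 1) k.succ).congr fun g => (face_arr_of_gt g h).symm

theorem continuous_firstVertex : (n : ℕ) → Continuous (firstVertex (G := G) n)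
  | 0 => continuous_id
  | n + 1 => continuous_rangeUnit.comp (continuous_arr n 0)

/-- A composable string of at least two elements is determined by its first entry and by the rest;
the topology is the one of the product. -/
theorem isInducing_arr_face (n : ℕ) :
    IsInducing fun g : Str G (n + 1 + 1) => (g.arr 0, face (n + 1) 0 g) := by
  have hc : Continuous fun p : G × Str G (n + 1) =>
      (Fin.cons p.1 p.2.arr : Fin (n + 1 + 1) → G) :=
    Continuous.finCons continuous_fst ((isEmbedding_arr n).continuous.comp continuous_snd)
  refine IsInducing.of_comp ((continuous_arr (n + 1) 0).prodMk (continuous_face (n + 1) 0)) hc ?_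
  have : ((fun p : G × Str G (n + 1) => (Fin.cons p.1 p.2.arr : Fin (n + 1 + 1) → G)) ∘
      fun g : Str G (n + 1 + 1) => (g.arr 0, face (n + 1) 0 g)) = Str.arr := by
    funext g k
    refine Fin.cases rfl (fun k => ?_) k
    exact face_arr_of_gt g (k := k) (Nat.succ_pos _)
  rw [this]
  exact (isEmbedding_arr (n + 1)).isInducing

theorem isOpenMap_firstVertex : (n : ℕ) → IsOpenMap (firstVertex (G := G) n)
  | 0 => IsOpenMap.id
  | 1 => by
    have hr : IsOpenMap (rangeUnit : G → UnitSpace G) := IsEtale.isLocalHomeomorph_range.isOpenMap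
    have h1 : IsOpenMap fun g : Str G 1 => g.arr 0 := by
      intro W hW
      obtain ⟨V, hV, rfl⟩ := (isEmbedding_arr 0).isInducing.isOpen_iff.mp hW
      have : (fun g : Str G 1 => g.arr 0) '' (Str.arr ⁻¹' V) = (fun a : G => fun _ : Fin 1 => a) ⁻¹' V := by
        ext a
        constructor
        · rintro ⟨g, hg, rfl⟩
          have : (fun _ : Fin 1 => g.arr 0) = g.arr := funext fun k => by rw [Subsingleton.elim k 0]
          simpa [this] using hg
        · intro ha
          exact ⟨Str.mk (fun _ => a) fun k => k.elim0, ha, rfl⟩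
      rw [this]
      exact hV.preimage (continuous_pi fun _ => continuous_id)
    exact hr.comp h1
  | n + 2 => by
    have hr : IsOpenMap (rangeUnit : G → UnitSpace G) := IsEtale.isLocalHomeomorph_range.isOpenMap
    have ih := isOpenMap_firstVertex (n + 1)
    rw [isOpenMap_iff_nhds_le]
    intro g W hW
    rw [Filter.mem_map, (isInducing_arr_face n).nhds_eq_comap g, nhds_prod_eq] at hW
    obtain ⟨T, hT, hTW⟩ := hW
    obtain ⟨U, hU, V, hV, hUV⟩ := Filter.mem_prod_iff.mp hT
    have hV' : firstVertex (n + 1) '' V ∈ 𝓝 (sourceUnit (g.arr 0)) := by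
      rw [← firstVertex_face_zero]
      exact ih.image_mem_nhds hV
    have hN : U ∩ sourceUnit ⁻¹' (firstVertex (n + 1) '' V) ∈ 𝓝 (g.arr 0) :=
      Filter.inter_mem hU (continuous_sourceUnit.continuousAt hV')
    refine Filter.mem_of_superset (hr.image_mem_nhds hN) ?_
    rintro _ ⟨a, ⟨haU, v, hvV, hv⟩, rfl⟩
    have hav : s a = r (v.arr 0) := congrArg Subtype.val hv.symm
    refine hTW (a := consStr a v hav) (hUV ⟨haU, ?_⟩)
    change face (n + 1) 0 (consStr a v hav) ∈ V
    rwa [face_consStr]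

theorem locallyInjective_firstVertex : (n : ℕ) → (g : Str G n) →
    ∃ U : Set (Str G n), IsOpen U ∧ g ∈ U ∧ Set.InjOn (firstVertex n) U
  | 0, _ => ⟨Set.univ, isOpen_univ, trivial, fun _ _ _ _ h => h⟩
  | 1, g => by
    obtain ⟨U, hU, hg, hi⟩ := (IsEtale.isLocalHomeomorph_range (G := G)).isLocallyInjective (g.arr 0)
    refine ⟨_, hU.preimage (continuous_arr 0 0), hg, fun a ha b hb hab => Str.ext fun k => ?_⟩
    obtain rfl : k = 0 := Fin.ext (by have := k.2; simp only [Fin.val_zero]; omega)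
    exact hi ha hb hab
  | n + 2, g => by
    obtain ⟨U, hU, hg, hi⟩ := (IsEtale.isLocalHomeomorph_range (G := G)).isLocallyInjective (g.arr 0)
    obtain ⟨V, hV, hg', hi'⟩ := locallyInjective_firstVertex (n + 1) (face (n + 1) 0 g)
    refine ⟨_, (hU.preimage (continuous_arr (n + 1) 0)).inter (hV.preimage
      (continuous_face (n + 1) 0)), ⟨hg, hg'⟩, fun a ha b hb hab => ?_⟩
    have h0 : a.arr 0 = b.arr 0 := hi ha.1 hb.1 hab
    refine str_ext_cons h0 (hi' ha.2 hb.2 ?_)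
    rw [firstVertex_face_zero, firstVertex_face_zero, h0]

theorem isLocalHomeomorph_firstVertex (n : ℕ) : IsLocalHomeomorph (firstVertex (G := G) n) :=
  isLocalHomeomorph_of_locallyInjective (continuous_firstVertex n) (isOpenMap_firstVertex n)
    (locallyInjective_firstVertex n)

theorem continuous_revStr : (n : ℕ) → Continuous (revStr (G := G) n)
  | 0 => continuous_id
  | n + 1 => by
    rw [(isEmbedding_arr n).continuous_iff, continuous_pi_iff]
    exact fun k => IsEtale.continuous_inv.comp (continuous_arr n k.rev)

theorem isLocalHomeomorph_lastVertex (n : ℕ) : IsLocalHomeomorph (lastVertex (G := G) n) := by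
  let e : Str G n ≃ₜ Str G n :=
    { toFun := revStr n
      invFun := revStr n
      left_inv := revStr_revStr n
      right_inv := revStr_revStr n
      continuous_toFun := continuous_revStr n
      continuous_invFun := continuous_revStr n }
  have : lastVertex (G := G) n = firstVertex n ∘ e := by
    funext g
    exact (firstVertex_revStr n g).symm
  rw [this]
  exact (isLocalHomeomorph_firstVertex n).comp e.isLocalHomeomorph

theorem isLocalHomeomorph_face (n : ℕ) (i : Fin (n + 2)) :
    IsLocalHomeomorph (face (G := G) n i) := by
  by_cases hi : i = 0
  · have hi' : i ≠ Fin.last (n + 1) := hi ▸ (Fin.last_pos.ne)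
    refine IsLocalHomeomorph.of_comp ?_ (isLocalHomeomorph_lastVertex n) (continuous_face n i)
    have : lastVertex (G := G) n ∘ face n i = lastVertex (n + 1) :=
      funext (lastVertex_face n i hi')
    rw [this]
    exact isLocalHomeomorph_lastVertex (n + 1)
  · refine IsLocalHomeomorph.of_comp ?_ (isLocalHomeomorph_firstVertex n) (continuous_face n i)
    have : firstVertex (G := G) n ∘ face n i = firstVertex (n + 1) :=
      funext (firstVertex_face n i hi)
    rw [this]
    exact isLocalHomeomorph_firstVertex (n + 1)

end Topology

/-! ### The Moore complex -/

section Complex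

universe u w

theorem alternating_sum_eq_zero {M : Type*} [AddCommGroup M] (n : ℕ)
    (F : Fin (n + 2) → Fin (n + 3) → M)
    (hF : ∀ i j : Fin (n + 2), i ≤ j → F i j.succ = F j i.castSucc) :
    ∑ i : Fin (n + 2), ∑ j : Fin (n + 3), ((-1 : ℤ) ^ (j : ℕ) * (-1 : ℤ) ^ (i : ℕ)) • F i j = 0 := by
  rw [← Finset.sum_product']
  let P := Fin (n + 2) × Fin (n + 3)
  let S : Finset P := {ij : P | (ij.2 : ℕ) ≤ (ij.1 : ℕ)}
  rw [Finset.univ_product_univ, ← Finset.sum_add_sum_compl S, ← eq_neg_iff_add_eq_zero,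
    ← Finset.sum_neg_distrib]
  let φ : ∀ ij : P, ij ∈ S → P := fun ij hij =>
    (Fin.castLT ij.2 (lt_of_le_of_lt (Finset.mem_filter.mp hij).right (Fin.is_lt ij.1)), ij.1.succ)
  apply Finset.sum_bij φ
  · intro ij hij
    simp_rw [S, φ, Finset.compl_filter, Finset.mem_filter_univ, Fin.val_succ,
      Fin.val_castLT] at hij ⊢
    omega
  · rintro ⟨i, j⟩ hij ⟨i', j'⟩ hij' h
    have h1 : (j : ℕ) = j' := congrArg (fun p : P => (p.1 : ℕ)) h
    have h2 : (i : ℕ) + 1 = i' + 1 := congrArg (fun p : P => (p.2 : ℕ)) h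
    exact Prod.ext (Fin.ext (Nat.succ_injective h2)) (Fin.ext h1)
  · rintro ⟨i', j'⟩ hij'
    simp_rw [S, Finset.compl_filter, Finset.mem_filter_univ, not_le] at hij'
    refine ⟨(j'.pred <| ?_, Fin.castSucc i'), ?_, ?_⟩
    · rintro rfl
      simp only [Fin.val_zero, not_lt_zero] at hij'
    · simpa [S] using! Nat.le_sub_one_of_lt hij'
    · simp only [φ, Fin.castLT_castSucc, Fin.succ_pred]
  · rintro ⟨i, j⟩ hij
    have hji : (j : ℕ) ≤ i := (Finset.mem_filter.mp hij).2
    simp only [φ, Fin.val_succ, Fin.val_castLT]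
    rw [hF _ _ (Fin.le_def.mpr hji), Fin.castSucc_castLT, ← neg_smul]
    congr 1
    ring

variable (G : Type u) [GroupoidStr G] [TopologicalSpace G] [IsEtale G]
  (A : Type w) [AddCommGroup A] [TopologicalSpace A] [IsTopologicalAddGroup A]

/-- The homomorphism `(dᵢ)_* : C_c(G⁽ⁿ⁺¹⁾, A) → C_c(G⁽ⁿ⁾, A)`. -/
noncomputable def facePush (n : ℕ) (i : Fin (n + 2)) : C_c(Str G (n + 1), A) →+ C_c(Str G n, A) :=
  push (face n i) (isLocalHomeomorph_face n i)

/-- The boundary map `∂ = ∑ᵢ (-1)ⁱ (dᵢ)_* : C_c(G⁽ⁿ⁺¹⁾, A) → C_c(G⁽ⁿ⁾, A)`. -/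
noncomputable def boundary (n : ℕ) : C_c(Str G (n + 1), A) →+ C_c(Str G n, A) :=
  ∑ i : Fin (n + 2), (-1 : ℤ) ^ (i : ℕ) • facePush G A n i

theorem boundary_apply (n : ℕ) (f : C_c(Str G (n + 1), A)) :
    boundary G A n f = ∑ i : Fin (n + 2), (-1 : ℤ) ^ (i : ℕ) • facePush G A n i f := by
  simp only [boundary, AddMonoidHom.finsetSum_apply, AddMonoidHom.coe_smul, Pi.smul_apply]

theorem facePush_facePush (n : ℕ) (i j : Fin (n + 2)) (hij : i ≤ j)
    (f : C_c(Str G (n + 1 + 1), A)) :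
    facePush G A n i (facePush G A (n + 1) j.succ f) =
      facePush G A n j (facePush G A (n + 1) i.castSucc f) := by
  have hχ := (isLocalHomeomorph_face (G := G) n j).comp (isLocalHomeomorph_face (n + 1) i.castSucc)
  refine (push_push _ _ hχ (fun g => face_face n i j hij g) f).trans ?_
  exact (push_push (isLocalHomeomorph_face (n + 1) i.castSucc) (isLocalHomeomorph_face n j) hχ
    (fun g => rfl) f).symm

theorem boundary_boundary (n : ℕ) (f : C_c(Str G (n + 1 + 1), A)) :
    boundary G A n (boundary G A (n + 1) f) = 0 := by
  simp only [boundary_apply, map_sum, map_zsmul, Finset.smul_sum, smul_smul]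
  rw [Finset.sum_comm]
  exact alternating_sum_eq_zero n (fun i j => facePush G A n i (facePush G A (n + 1) j f))
    fun i j hij => facePush_facePush G A n i j hij f

/-- The Moore complex `𝓒(G, A)`. -/
noncomputable def mooreComplex : ChainComplex AddCommGrpCat.{max u w} ℕ :=
  ChainComplex.of (fun n => AddCommGrpCat.of C_c(Str G n, A))
    (fun n => AddCommGrpCat.ofHom (boundary G A n)) fun n => by
      refine AddCommGrpCat.hom_ext (AddMonoidHom.ext fun f => ?_)
      exact boundary_boundary G A n f

theorem mooreComplex_d (n : ℕ) :
    (mooreComplex G A).d (n + 1) n = AddCommGrpCat.ofHom (boundary G A n) :=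
  ChainComplex.of_d (fun n => AddCommGrpCat.of C_c(Str G n, A))
    (fun n => AddCommGrpCat.ofHom (boundary G A n)) n

end Complex

end Groupoid

/-! ### Factor maps of étale groupoids -/

section Factor

open GroupoidStr

universe u w

variable {G G' : Type u} [GroupoidStr G] [GroupoidStr G'] [TopologicalSpace G]
  [TopologicalSpace G']

/-- The factor groupoid situation: `π : G → G'` is a groupoid homomorphism which is surjective,
continuous and proper (`IsProperMap` includes continuity), and which for every unit `x` maps
`r⁻¹(x)` bijectively onto `r⁻¹(π(x))`. -/
class IsFactorMap (π : G → G') : Prop where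
  map_r : ∀ g, π (r g) = r (π g)
  map_s : ∀ g, π (s g) = s (π g)
  map_mul : ∀ (g h : G) (e : s g = r h),
    π (mul g h e) = mul (π g) (π h) ((map_s g).symm.trans ((congrArg π e).trans (map_r h)))
  surjective : Function.Surjective π
  isProperMap : IsProperMap π
  bijOn : ∀ x : G, r x = x → Set.BijOn π {g | r g = x} {g' | r g' = π x}

variable (π : G → G') [IsFactorMap π]

/-- The map `π⁽⁰⁾ : G⁽⁰⁾ → G'⁽⁰⁾`. -/
def unitMap (x : UnitSpace G) : UnitSpace G' :=
  ⟨π x.1, (IsFactorMap.map_r x.1).symm.trans (congrArg π x.2)⟩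

/-- The map `π⁽ⁿ⁾ : G⁽ⁿ⁾ → G'⁽ⁿ⁾`, `(g₁, …, gₙ) ↦ (π(g₁), …, π(gₙ))`. -/
def strMap : (n : ℕ) → Str G n → Str G' n
  | 0, x => unitMap π x.pt
  | _ + 1, g => Str.mk (fun k => π (g.arr k)) fun k =>
      (IsFactorMap.map_s _).symm.trans ((congrArg π (g.comp k)).trans (IsFactorMap.map_r _))

theorem strMap_arr (n : ℕ) (g : Str G (n + 1)) (k : Fin (n + 1)) :
    (strMap π (n + 1) g).arr k = π (g.arr k) := rfl

theorem unitMap_rangeUnit (g : G) : unitMap π (rangeUnit g) = rangeUnit (π g) :=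
  Subtype.ext (IsFactorMap.map_r g)

theorem unitMap_sourceUnit (g : G) : unitMap π (sourceUnit g) = sourceUnit (π g) :=
  Subtype.ext (IsFactorMap.map_s g)

theorem map_inv (g : G) : π (inv g) = inv (π g) := by
  refine inv_unique ?_ ?_
  · rw [← IsFactorMap.map_s (π := π), ← IsFactorMap.map_r (π := π), r_inv]
  · rw [← IsFactorMap.map_mul (π := π) g (inv g) (r_inv g).symm, GroupoidStr.mul_inv,
      IsFactorMap.map_r (π := π)]

theorem firstVertex_strMap : (n : ℕ) → (g : Str G n) →
    firstVertex n (strMap π n g) = unitMap π (firstVertex n g)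
  | 0, _ => rfl
  | _ + 1, g => (unitMap_rangeUnit π (g.arr 0)).symm

theorem lastVertex_strMap : (n : ℕ) → (g : Str G n) →
    lastVertex n (strMap π n g) = unitMap π (lastVertex n g)
  | 0, _ => rfl
  | n + 1, g => (unitMap_sourceUnit π (g.arr (Fin.last n))).symm

theorem revStr_strMap : (n : ℕ) → (g : Str G n) →
    revStr n (strMap π n g) = strMap π n (revStr n g)
  | 0, _ => rfl
  | _ + 1, g => Str.ext fun k => (map_inv π (g.arr k.rev)).symm

theorem strMap_face : (n : ℕ) → (i : Fin (n + 2)) → (g : Str G (n + 1)) →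
    strMap π n (face n i g) = face n i (strMap π (n + 1) g)
  | 0, i, g => by
    by_cases h : i = 0
    · subst h; exact unitMap_sourceUnit π (g.arr 0)
    · have h1 : face 0 i g = rangeUnit (g.arr 0) := if_neg h
      have h2 : face 0 i (strMap π 1 g) = rangeUnit ((strMap π 1 g).arr 0) := if_neg h
      rw [h1, h2]
      exact unitMap_rangeUnit π (g.arr 0)
  | n + 1, i, g => Str.ext fun k => by
    rw [strMap_arr]
    rcases lt_trichotomy ((k : ℕ) + 1) i with h | h | h
    · rw [face_arr_of_lt _ h, face_arr_of_lt _ h]; rfl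
    · rw [face_arr_of_eq _ h, face_arr_of_eq _ h, IsFactorMap.map_mul (π := π)]; rfl
    · rw [face_arr_of_gt _ h, face_arr_of_gt _ h]; rfl

theorem strMap_injective_of_firstVertex : (n : ℕ) → (g h : Str G n) →
    strMap π n g = strMap π n h → firstVertex n g = firstVertex n h → g = h
  | 0, _, _, _, h => h
  | n + 1, g, h, e, ev => by
    have h0 : g.arr 0 = h.arr 0 :=
      (IsFactorMap.bijOn (π := π) (r (g.arr 0)) (r_r _)).injOn rfl
        (congrArg Subtype.val ev).symm (congrArg (fun a : Str G' (n + 1) => a.arr 0) e)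
    cases n with
    | zero =>
      refine Str.ext fun k => ?_
      obtain rfl : k = 0 := Fin.ext (by have := k.2; simp only [Fin.val_zero]; omega)
      exact h0
    | succ n =>
      refine str_ext_cons h0 (strMap_injective_of_firstVertex (n + 1) _ _ ?_ ?_)
      · rw [strMap_face, strMap_face, e]
      · rw [firstVertex_face_zero, firstVertex_face_zero, h0]

theorem exists_strMap_eq_of_firstVertex : (n : ℕ) → (z : Str G' n) → (x : UnitSpace G) →
    unitMap π x = firstVertex n z → ∃ g : Str G n, strMap π n g = z ∧ firstVertex n g = x
  | 0, _, x, h => ⟨x, h, rfl⟩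
  | n + 1, z, x, h => by
    obtain ⟨a, ha, haz⟩ := (IsFactorMap.bijOn (π := π) x.1 x.2).surjOn
      (show r (z.arr 0) = π x.1 from (congrArg Subtype.val h).symm)
    have ha : r a = x.1 := ha
    cases n with
    | zero =>
      refine ⟨Str.mk (fun _ => a) fun k => k.elim0, Str.ext fun k => ?_, Subtype.ext ha⟩
      obtain rfl : k = 0 := Fin.ext (by have := k.2; simp only [Fin.val_zero]; omega)
      exact haz
    | succ n =>
      obtain ⟨g, hg, hgx⟩ := exists_strMap_eq_of_firstVertex (n + 1) (face (n + 1) 0 z)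
        (sourceUnit a) (by rw [unitMap_sourceUnit, haz, firstVertex_face_zero])
      have hag : s a = r (g.arr 0) := (congrArg Subtype.val hgx).symm
      refine ⟨consStr a g hag, str_ext_cons haz ?_, Subtype.ext ha⟩
      rw [← strMap_face, face_consStr, hg]

theorem strMap_injective_of_lastVertex (n : ℕ) (g h : Str G n)
    (e : strMap π n g = strMap π n h) (ev : lastVertex n g = lastVertex n h) : g = h := by
  rw [← revStr_revStr n g, ← revStr_revStr n h]
  congr 1
  refine strMap_injective_of_firstVertex π n _ _ ?_ ?_
  · rw [← revStr_strMap, ← revStr_strMap, e]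
  · rw [firstVertex_revStr, firstVertex_revStr, ev]

theorem exists_strMap_eq_of_lastVertex (n : ℕ) (z : Str G' n) (x : UnitSpace G)
    (h : unitMap π x = lastVertex n z) : ∃ g : Str G n, strMap π n g = z ∧ lastVertex n g = x := by
  obtain ⟨g, hg, hx⟩ := exists_strMap_eq_of_firstVertex π n (revStr n z) x
    (by rw [firstVertex_revStr, h])
  refine ⟨revStr n g, ?_, ?_⟩
  · rw [← revStr_strMap, hg, revStr_revStr]
  · rw [lastVertex_revStr, hx]

theorem bijOn_strMap_face (n : ℕ) (i : Fin (n + 2)) (y : Str G n) :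
    Set.BijOn (strMap π (n + 1)) (face n i ⁻¹' {y}) (face n i ⁻¹' {strMap π n y}) := by
  refine ⟨fun g hg => ?_, fun g hg h hh e => ?_, fun z hz => ?_⟩
  · have hg : face n i g = y := hg
    change face n i (strMap π (n + 1) g) = strMap π n y
    rw [← strMap_face, hg]
  · have hgh : face n i g = face n i h := Eq.trans hg (Eq.symm hh)
    by_cases hi : i = 0
    · have hi' : i ≠ Fin.last (n + 1) := hi ▸ (Fin.last_pos.ne)
      refine strMap_injective_of_lastVertex π _ _ _ e ?_
      rw [← lastVertex_face n i hi', ← lastVertex_face n i hi', hgh]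
    · refine strMap_injective_of_firstVertex π _ _ _ e ?_
      rw [← firstVertex_face n i hi, ← firstVertex_face n i hi, hgh]
  · have hz : face n i z = strMap π n y := hz
    by_cases hi : i = 0
    · have hi' : i ≠ Fin.last (n + 1) := hi ▸ (Fin.last_pos.ne)
      obtain ⟨g, rfl, hv⟩ := exists_strMap_eq_of_lastVertex π (n + 1) z (lastVertex n y)
        (by rw [← lastVertex_face n i hi', hz, lastVertex_strMap])
      refine ⟨g, ?_, rfl⟩
      refine strMap_injective_of_lastVertex π n _ _ ((strMap_face π n i g).trans hz) ?_
      rw [lastVertex_face n i hi', hv]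
    · obtain ⟨g, rfl, hv⟩ := exists_strMap_eq_of_firstVertex π (n + 1) z (firstVertex n y)
        (by rw [← firstVertex_face n i hi, hz, firstVertex_strMap])
      refine ⟨g, ?_, rfl⟩
      refine strMap_injective_of_firstVertex π n _ _ ((strMap_face π n i g).trans hz) ?_
      rw [firstVertex_face n i hi, hv]

/-! ### The relative complex `𝓒(G, A) / 𝓒(G', A)` -/

variable [IsEtale G]

theorem isProperMap_strMap : (n : ℕ) → IsProperMap (strMap π n)
  | 0 => by
    have : T2Space G := IsEtale.hausdorff
    have hcl : IsClosedEmbedding (Subtype.val : UnitSpace G → G) :=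
      (isClosed_eq continuous_r continuous_id).isClosedEmbedding_subtypeVal
    have hp : IsProperMap (fun x : UnitSpace G => π x.1) :=
      (IsFactorMap.isProperMap (π := π)).comp hcl.isProperMap
    exact isProperMap_of_comp_of_inj (hp.continuous.subtype_mk fun x => (unitMap π x).2)
      continuous_subtype_val hp Subtype.val_injective
  | n + 1 => by
    have hp : IsProperMap (fun g : Str G (n + 1) => fun k => π (g.arr k)) :=
      (IsProperMap.pi_map fun _ => IsFactorMap.isProperMap (π := π)).comp
        (isClosedEmbedding_arr n).isProperMap
    exact isProperMap_of_comp_of_inj ((isEmbedding_arr n).continuous_iff.mpr hp.continuous)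
      (isEmbedding_arr n).continuous hp (isEmbedding_arr n).injective

variable [IsEtale G'] (A : Type w) [AddCommGroup A] [TopologicalSpace A] [IsTopologicalAddGroup A]

/-- The homomorphism `(π⁽ⁿ⁾)^* : C_c(G'⁽ⁿ⁾, A) → C_c(G⁽ⁿ⁾, A)`. -/
noncomputable def strPull (n : ℕ) : C_c(Str G' n, A) →+ C_c(Str G n, A) :=
  pull (strMap π n) (isProperMap_strMap π n)

theorem boundary_strPull (n : ℕ) (f : C_c(Str G' (n + 1), A)) :
    boundary G A n (strPull π A (n + 1) f) = strPull π A n (boundary G' A n f) := by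
  simp only [boundary_apply, map_sum, map_zsmul]
  refine Finset.sum_congr rfl fun i _ => congrArg _ ?_
  exact push_pull _ _ _ _ (bijOn_strMap_face π n i) f

/-- The quotient group `C_c(G⁽ⁿ⁾, A) / C_c(G'⁽ⁿ⁾, A)`, where `C_c(G'⁽ⁿ⁾, A)` is embedded by the
pull-back along `π⁽ⁿ⁾`. -/
abbrev RelGroup (n : ℕ) : Type (max u w) := C_c(Str G n, A) ⧸ (strPull π A n).range

/-- The boundary map of the quotient complex. -/
noncomputable def relBoundary (n : ℕ) : RelGroup π A (n + 1) →+ RelGroup π A n :=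
  QuotientAddGroup.map _ _ (boundary G A n) <| by
    rintro _ ⟨f, rfl⟩
    exact ⟨boundary G' A n f, (boundary_strPull π A n f).symm⟩

/-- The quotient chain complex `𝓒(G, A) / 𝓒(G', A)`. -/
noncomputable def relComplex : ChainComplex AddCommGrpCat.{max u w} ℕ :=
  ChainComplex.of (fun n => AddCommGrpCat.of (RelGroup π A n))
    (fun n => AddCommGrpCat.ofHom (relBoundary π A n)) fun n => by
      refine AddCommGrpCat.hom_ext (AddMonoidHom.ext fun c => ?_)
      obtain ⟨f, rfl⟩ := QuotientAddGroup.mk_surjective c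
      exact congrArg (QuotientAddGroup.mk (s := (strPull π A n).range)) (boundary_boundary G A n f)

theorem relComplex_d (n : ℕ) :
    (relComplex π A).d (n + 1) n = AddCommGrpCat.ofHom (relBoundary π A n) :=
  ChainComplex.of_d (fun n => AddCommGrpCat.of (RelGroup π A n))
    (fun n => AddCommGrpCat.ofHom (relBoundary π A n)) n

/-- The chain map `π^* : 𝓒(G', A) → 𝓒(G, A)`. -/
noncomputable def pullComplex : mooreComplex G' A ⟶ mooreComplex G A :=
  ChainComplex.ofHom (fun n => AddCommGrpCat.ofHom (strPull π A n)) fun n => by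
    rw [mooreComplex_d, mooreComplex_d]
    exact AddCommGrpCat.hom_ext (AddMonoidHom.ext fun f => boundary_strPull π A n f)

/-- The quotient map `𝓒(G, A) → 𝓒(G, A) / 𝓒(G', A)`. -/
noncomputable def projComplex : mooreComplex G A ⟶ relComplex π A :=
  ChainComplex.ofHom (fun n => AddCommGrpCat.ofHom (QuotientAddGroup.mk' (strPull π A n).range))
    fun n => by
      rw [mooreComplex_d, relComplex_d]
      rfl

/-- The sequence `𝓒(G', A) → 𝓒(G, A) → 𝓒(G, A) / 𝓒(G', A)`. -/
noncomputable def relSequence : ShortComplex (ChainComplex AddCommGrpCat.{max u w} ℕ) :=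
  ShortComplex.mk (pullComplex π A) (projComplex π A) <| by
    ext n : 1
    refine AddCommGrpCat.hom_ext (AddMonoidHom.ext fun f => ?_)
    exact (QuotientAddGroup.eq_zero_iff (N := (strPull π A n).range) _).mpr ⟨f, rfl⟩

end Factor

/-! ### Regular maps -/

section Regular

variable {X X' A : Type*}

/-- Regularity of a (continuous proper surjective) map `π : X → X'`: every `x'` has, for every
`ε > 0`, an open neighbourhood `U'` such that for all `y' ∈ U'` the Hausdorff distance of the fibres
of `x'` and `y'` is less than `ε`, or the diameter of the fibre of `y'` is less than `ε`. -/
def IsRegularMap [PseudoMetricSpace X] [TopologicalSpace X'] (π : X → X') : Prop :=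
  ∀ (x' : X') (ε : ℝ), 0 < ε → ∃ U' : Set X', IsOpen U' ∧ x' ∈ U' ∧ ∀ y' ∈ U',
    Metric.hausdorffDist (π ⁻¹' {x'}) (π ⁻¹' {y'}) < ε ∨ Metric.diam (π ⁻¹' {y'}) < ε

/-- The set `X'_π` of the points of `X'` with more than one preimage. -/
def SplitTarget (π : X → X') : Type _ := {x' : X' // (π ⁻¹' {x'}).Nontrivial}

/-- The set `X_π = π⁻¹(X'_π)`. -/
def SplitSource (π : X → X') : Type _ := {x : X // (π ⁻¹' {π x}).Nontrivial}

/-- The restriction `π : X_π → X'_π`. -/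
def splitMap (π : X → X') (x : SplitSource π) : SplitTarget π := ⟨π x.1, x.2⟩

/-- `X'_π` carries the Hausdorff metric of the fibres. (If `π` is proper, then the fibres over
`X'_π` are nonempty and compact, so that the distance is finite.) -/
noncomputable instance [PseudoEMetricSpace X] (π : X → X') :
    PseudoEMetricSpace (SplitTarget π) where
  edist x' y' := Metric.hausdorffEDist (π ⁻¹' {x'.1}) (π ⁻¹' {y'.1})
  edist_self _ := Metric.hausdorffEDist_self
  edist_comm _ _ := Metric.hausdorffEDist_comm
  edist_triangle _ _ _ := Metric.hausdorffEDist_triangle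

/-- `X_π` carries the sum of the metric of `X` and of the Hausdorff metric of the fibres. -/
noncomputable instance [PseudoEMetricSpace X] (π : X → X') :
    PseudoEMetricSpace (SplitSource π) where
  edist x y := edist x.1 y.1 + edist (splitMap π x) (splitMap π y)
  edist_self _ := by rw [edist_self, edist_self, add_zero]
  edist_comm x y := by rw [edist_comm x.1, edist_comm (splitMap π x)]
  edist_triangle x y z := by
    refine (add_le_add (edist_triangle x.1 y.1 z.1) (edist_triangle (splitMap π x) (splitMap π y)
      (splitMap π z))).trans_eq ?_
    rw [add_add_add_comm]

open Classical in
/-- For `f : X → A` and `K' ⊆ X'_π`, the function `f_{K'} : X_π → A` which equals `f` on `π⁻¹(K')`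
and vanishes elsewhere. -/
noncomputable def truncate [Zero A] (π : X → X') (f : X → A) (K' : Set (SplitTarget π))
    (x : SplitSource π) : A :=
  if splitMap π x ∈ K' then f x.1 else 0

end Regular

section StrMetric

open GroupoidStr

variable {G : Type*} [GroupoidStr G] [PseudoEMetricSpace G]

/-- The `ℓ¹`-metric on `G⁽ⁿ⁾`, for `n ≥ 1`. -/
@[reducible]
noncomputable def ellOneMetric : (n : ℕ) → PseudoEMetricSpace (Str G n)
  | 0 => inferInstanceAs (PseudoEMetricSpace (UnitSpace G))
  | n + 1 =>
    { edist := fun g h => ∑ k, edist (g.arr k) (h.arr k)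
      edist_self := fun g => by simp
      edist_comm := fun g h => Finset.sum_congr rfl fun k _ => edist_comm _ _
      edist_triangle := fun g h i => by
        rw [← Finset.sum_add_distrib]
        exact Finset.sum_le_sum fun k _ => edist_triangle _ _ _ }

theorem ellOneMetric_topology : (n : ℕ) → instTopologicalSpaceStr (G := G) n =
    (ellOneMetric n).toUniformSpace.toTopologicalSpace
  | 0 => rfl
  | n + 1 => by
    let e : Str G (n + 1) → PiLp 1 (fun _ : Fin (n + 1) => G) := fun g => WithLp.toLp 1 g.arr
    have h1 : ellOneMetric (G := G) (n + 1) = PseudoEMetricSpace.induced e inferInstance := by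
      refine PseudoEMetricSpace.ext (congrArg EDist.mk (funext fun g => funext fun h => ?_))
      change ∑ k, edist (g.arr k) (h.arr k) = edist (e g) (e h)
      rw [PiLp.edist_eq_sum (by norm_num)]
      simp [e]
    have h2 : IsInducing e :=
      (PiLp.homeomorph 1 fun _ : Fin (n + 1) => G).symm.isInducing.comp (isEmbedding_arr n).isInducing
    rw [h1]
    exact h2.eq_induced

/-- `G⁽ⁿ⁾` carries the restriction of the metric of `G` for `n = 0`, and the restriction of the
`ℓ¹`-metric of `Gⁿ` for `n ≥ 1`; its topology is the one above. -/
noncomputable instance instPseudoEMetricSpaceStr (n : ℕ) : PseudoEMetricSpace (Str G n) :=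
  { ellOneMetric n with
    toUniformSpace := (ellOneMetric n).toUniformSpace.replaceTopology (ellOneMetric_topology n)
    uniformity_edist := (ellOneMetric n).uniformity_edist }

theorem edist_str (n : ℕ) (g h : Str G (n + 1)) :
    edist g h = ∑ k, edist (g.arr k) (h.arr k) := rfl

end StrMetric

/-! ### The groupoids `G_π` and `G'_π` -/

section Split

open GroupoidStr

universe u w

variable {G G' : Type u} [GroupoidStr G] [GroupoidStr G']

section Algebra

variable [TopologicalSpace G] [TopologicalSpace G'] (π : G → G') [IsFactorMap π]

theorem eq_r_of_map_unit {x : G} (h : r (π x) = π x) : r x = x := by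
  refine (IsFactorMap.bijOn (π := π) (r x) (r_r x)).injOn (r_r x) rfl ?_
  rw [IsFactorMap.map_r (π := π), h]

theorem nontrivial_fiber_r {g' : G'} :
    (π ⁻¹' {r g'}).Nontrivial ↔ (π ⁻¹' {g'}).Nontrivial := by
  constructor
  · rintro ⟨x, hx, y, hy, hxy⟩
    have hx : π x = r g' := hx
    have hy : π y = r g' := hy
    have hxu : r x = x := eq_r_of_map_unit π (by rw [hx, r_r])
    have hyu : r y = y := eq_r_of_map_unit π (by rw [hy, r_r])
    obtain ⟨a, ha, hag⟩ := (IsFactorMap.bijOn (π := π) x hxu).surjOn (show r g' = π x from hx.symm)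
    obtain ⟨b, hb, hbg⟩ := (IsFactorMap.bijOn (π := π) y hyu).surjOn (show r g' = π y from hy.symm)
    refine ⟨a, hag, b, hbg, fun hab => hxy ?_⟩
    have ha : r a = x := ha
    have hb : r b = y := hb
    rw [← ha, ← hb, hab]
  · rintro ⟨a, ha, b, hb, hab⟩
    have ha : π a = g' := ha
    have hb : π b = g' := hb
    refine ⟨r a, ?_, r b, ?_, fun h => hab ?_⟩
    · change π (r a) = r g'
      rw [IsFactorMap.map_r (π := π), ha]
    · change π (r b) = r g'
      rw [IsFactorMap.map_r (π := π), hb]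
    · exact (IsFactorMap.bijOn (π := π) (r a) (r_r a)).injOn rfl h.symm (ha.trans hb.symm)

theorem nontrivial_fiber_inv {g' : G'} (h : (π ⁻¹' {g'}).Nontrivial) :
    (π ⁻¹' {inv g'}).Nontrivial := by
  obtain ⟨a, ha, b, hb, hab⟩ := h
  have ha : π a = g' := ha
  have hb : π b = g' := hb
  refine ⟨inv a, ?_, inv b, ?_, fun h => hab ?_⟩
  · change π (inv a) = inv g'
    rw [map_inv π, ha]
  · change π (inv b) = inv g'
    rw [map_inv π, hb]
  · rw [← inv_inv a, h, inv_inv]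

theorem nontrivial_fiber_s {g' : G'} (h : (π ⁻¹' {g'}).Nontrivial) :
    (π ⁻¹' {s g'}).Nontrivial := by
  rw [← r_inv, nontrivial_fiber_r]
  exact nontrivial_fiber_inv π h

theorem nontrivial_fiber_mul {g' h' : G'} (e : s g' = r h') (h : (π ⁻¹' {g'}).Nontrivial) :
    (π ⁻¹' {mul g' h' e}).Nontrivial := by
  rw [← nontrivial_fiber_r, r_mul, nontrivial_fiber_r]
  exact h

/-- `G'_π` is a subgroupoid of `G'`. -/
instance : GroupoidStr (SplitTarget π) where
  r a := ⟨r a.1, (nontrivial_fiber_r π).mpr a.2⟩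
  s a := ⟨s a.1, nontrivial_fiber_s π a.2⟩
  inv a := ⟨inv a.1, nontrivial_fiber_inv π a.2⟩
  mul a b e := ⟨mul a.1 b.1 (congrArg Subtype.val e), nontrivial_fiber_mul π _ a.2⟩
  r_mul _ _ _ := Subtype.ext (r_mul _ _ _)
  s_mul _ _ _ := Subtype.ext (s_mul _ _ _)
  mul_assoc _ _ _ _ _ := Subtype.ext (GroupoidStr.mul_assoc _ _ _ _ _)
  s_r _ := Subtype.ext (s_r _)
  r_s _ := Subtype.ext (r_s _)
  r_mul_self _ := Subtype.ext (r_mul_self _)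
  mul_s_self _ := Subtype.ext (mul_s_self _)
  r_inv _ := Subtype.ext (r_inv _)
  s_inv _ := Subtype.ext (s_inv _)
  mul_inv _ := Subtype.ext (GroupoidStr.mul_inv _)
  inv_mul _ := Subtype.ext (inv_mul _)

/-- `G_π` is a subgroupoid of `G`. -/
instance : GroupoidStr (SplitSource π) where
  r a := ⟨r a.1, by rw [IsFactorMap.map_r (π := π)]; exact (nontrivial_fiber_r π).mpr a.2⟩
  s a := ⟨s a.1, by rw [IsFactorMap.map_s (π := π)]; exact nontrivial_fiber_s π a.2⟩
  inv a := ⟨inv a.1, by rw [map_inv π]; exact nontrivial_fiber_inv π a.2⟩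
  mul a b e := ⟨mul a.1 b.1 (congrArg Subtype.val e), by
    rw [IsFactorMap.map_mul (π := π)]; exact nontrivial_fiber_mul π _ a.2⟩
  r_mul _ _ _ := Subtype.ext (r_mul _ _ _)
  s_mul _ _ _ := Subtype.ext (s_mul _ _ _)
  mul_assoc _ _ _ _ _ := Subtype.ext (GroupoidStr.mul_assoc _ _ _ _ _)
  s_r _ := Subtype.ext (s_r _)
  r_s _ := Subtype.ext (r_s _)
  r_mul_self _ := Subtype.ext (r_mul_self _)
  mul_s_self _ := Subtype.ext (mul_s_self _)
  r_inv _ := Subtype.ext (r_inv _)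
  s_inv _ := Subtype.ext (s_inv _)
  mul_inv _ := Subtype.ext (GroupoidStr.mul_inv _)
  inv_mul _ := Subtype.ext (inv_mul _)

/-- A composable string of elements of `G'_π`, as a composable string in `G'`. -/
def targetIncl : (n : ℕ) → Str (SplitTarget π) n → Str G' n
  | 0, x => (⟨x.pt.1.1, congrArg Subtype.val x.pt.2⟩ : UnitSpace G')
  | _ + 1, g => Str.mk (fun k => (g.arr k).1) fun k => congrArg Subtype.val (g.comp k)

/-- A composable string of elements of `G_π`, as a composable string in `G`. -/
def sourceIncl : (n : ℕ) → Str (SplitSource π) n → Str G n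
  | 0, x => (⟨x.pt.1.1, congrArg Subtype.val x.pt.2⟩ : UnitSpace G)
  | _ + 1, g => Str.mk (fun k => (g.arr k).1) fun k => congrArg Subtype.val (g.comp k)

theorem nontrivial_fiber_strMap (n : ℕ) (z : Str G' n)
    (h : (π ⁻¹' {(firstVertex n z).1}).Nontrivial) : (strMap π n ⁻¹' {z}).Nontrivial := by
  obtain ⟨x, hx, y, hy, hxy⟩ := h
  have hx : π x = (firstVertex n z).1 := hx
  have hy : π y = (firstVertex n z).1 := hy
  have hxu : r x = x := eq_r_of_map_unit π (by rw [hx, (firstVertex n z).2])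
  have hyu : r y = y := eq_r_of_map_unit π (by rw [hy, (firstVertex n z).2])
  obtain ⟨a, ha, hax⟩ := exists_strMap_eq_of_firstVertex π n z ⟨x, hxu⟩ (Subtype.ext hx)
  obtain ⟨b, hb, hby⟩ := exists_strMap_eq_of_firstVertex π n z ⟨y, hyu⟩ (Subtype.ext hy)
  refine ⟨a, ha, b, hb, fun hab => hxy ?_⟩
  rw [hab, hby] at hax
  exact (congrArg Subtype.val hax).symm

theorem nontrivial_fiber_targetIncl : (n : ℕ) → (g : Str (SplitTarget π) n) →
    (strMap π n ⁻¹' {targetIncl π n g}).Nontrivial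
  | 0, x => nontrivial_fiber_strMap π 0 _ x.pt.1.2
  | n + 1, g => nontrivial_fiber_strMap π (n + 1) _ ((nontrivial_fiber_r π).mpr (g.arr 0).2)

theorem nontrivial_fiber_sourceIncl : (n : ℕ) → (g : Str (SplitSource π) n) →
    (strMap π n ⁻¹' {strMap π n (sourceIncl π n g)}).Nontrivial
  | 0, x => nontrivial_fiber_strMap π 0 _ x.pt.1.2
  | n + 1, g => nontrivial_fiber_strMap π (n + 1) _ ((nontrivial_fiber_r π).mpr (g.arr 0).2)

/-- The canonical map `(G'_π)⁽ⁿ⁾ → (G'⁽ⁿ⁾)_{π⁽ⁿ⁾}`, which is the identity on the entries. -/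
def strTarget (n : ℕ) (g : Str (SplitTarget π) n) : SplitTarget (strMap π n) :=
  ⟨targetIncl π n g, nontrivial_fiber_targetIncl π n g⟩

/-- The canonical map `G_π⁽ⁿ⁾ → (G⁽ⁿ⁾)_{π⁽ⁿ⁾}`, which is the identity on the entries. -/
def strSource (n : ℕ) (g : Str (SplitSource π) n) : SplitSource (strMap π n) :=
  ⟨sourceIncl π n g, nontrivial_fiber_sourceIncl π n g⟩

end Algebra

variable [MetricSpace G] [MetricSpace G'] (π : G → G') [IsFactorMap π]
  [IsEtale (SplitSource π)] [IsEtale (SplitTarget π)] [IsFactorMap (splitMap π)]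
  {A : Type w} [AddCommGroup A] [TopologicalSpace A] [IsTopologicalAddGroup A]

/-- `c` is the image of `f ∈ C_c(G⁽ⁿ⁾, A)` under the reduction map arising from `π⁽ⁿ⁾`: for every
sufficiently large compact open set `K' ⊆ (G'⁽ⁿ⁾)_{π⁽ⁿ⁾}`, the function `f_{K'}` on
`(G⁽ⁿ⁾)_{π⁽ⁿ⁾}`, regarded as a function on `G_π⁽ⁿ⁾`, belongs to `C_c(G_π⁽ⁿ⁾, A)`, and its class
modulo `C_c((G'_π)⁽ⁿ⁾, A)` is `c`. -/
def IsReduction (n : ℕ) (f : C_c(Str G n, A)) (c : RelGroup (splitMap π) A n) : Prop :=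
  ∃ L' : Set (SplitTarget (strMap π n)), IsCompact L' ∧ IsOpen L' ∧
    ∀ K' : Set (SplitTarget (strMap π n)), IsCompact K' → IsOpen K' → L' ⊆ K' →
      ∃ F : C_c(Str (SplitSource π) n, A),
        (∀ x, F x = truncate (strMap π n) f K' (strSource π n x)) ∧
        (QuotientAddGroup.mk F : RelGroup (splitMap π) A n) = c

end Split

end EtaleFactor

open EtaleFactor

universe u w

set_option linter.unusedSectionVars false

namespace EtaleFactor

/-! ### Regularity in terms of the extended distance, and control of fibres by continuous functions.
-/

section RegularFibres

open Metric Filter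
open scoped ENNReal

/-! Two mechanisms carry the proof, one for the topology of the split spaces and one for the
reduction map.

Topology. By regularity, the points of a compact subset of `X'` whose fibres have diameter at least
`ε > 0` form a compact subset of `X'_π` (`isCompact_splitTarget`): along a convergent ultrafilter of
such points the small-diameter alternative is excluded, so the fibres converge in the Hausdorff
metric. This makes `X'_π` locally compact and σ-compact, hence second countable, and `X_π` inherits
these properties because it is proper over `X'_π`. Next, suppose that a continuous map `v` sends the
fibres of one proper map bijectively onto fibres of another. By properness, near a given fibre
smallness of distances before and after `v` are equivalent (`exists_fibre_modulus`). Hence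
regularity can be pulled back along `v`, and the topology of the split target is induced by the
inclusion together with the map to the other split target (`FibreBij.isInducing`). Since one entry
of a string, or the range of an element, determines the lift once its own lift is chosen, this
applies to the range, the inverse and the entries of strings. It yields the étale structures and the
identification of strings of split elements with split strings.

Reduction. A compactly supported function with discrete values has a Lebesgue number `ε`, so it can
fail to be constant only on fibres of diameter at least `ε` that meet its support; these lie over a
compact set of split points (`HasRegularFibres.fibreConstAtInfinity`). Truncations at two compact
open sets containing that set therefore differ by a pull-back. The kernel of the resulting
homomorphism consists of the functions constant on all fibres, which are the pull-backs
(`mem_range_pull_iff`). Surjectivity comes from extending a function from a compact set and cutting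
the extension off over a compact open subset of `X'`. Finally, truncating before or after a
push-forward changes the result by a sum over points at which the function depends only on the image
under `π`, hence by a pull-back (`SplitSquare.mk_push_restrict`); so the isomorphisms commute with
the boundary maps. -/

theorem ediam_le_ediam_add_hausdorffEDist {X : Type*} [PseudoEMetricSpace X] {S T : Set X}
    {η : ℝ≥0∞} (h : hausdorffEDist S T < η) : ediam S ≤ ediam T + 2 * η := by
  refine ediam_le fun a ha b hb => ?_
  obtain ⟨a', ha', haa⟩ := exists_edist_lt_of_hausdorffEDist_lt ha h
  obtain ⟨b', hb', hbb⟩ := exists_edist_lt_of_hausdorffEDist_lt hb h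
  calc edist a b ≤ edist a a' + edist a' b' + edist b' b := edist_triangle4 _ _ _ _
    _ ≤ η + ediam T + η := by
        gcongr
        · exact edist_le_ediam_of_mem ha' hb'
        · rw [edist_comm]; exact hbb.le
    _ = ediam T + 2 * η := by ring

/-- Transfers a modulus of continuity from points to Hausdorff distances. The conclusion is only a
weak inequality, so the applications interpolate some `ε'` below the desired `ε`. -/
theorem hausdorffEDist_image_le {X Y Z : Type*} [PseudoEMetricSpace Y] [PseudoEMetricSpace Z]
    {u : X → Y} {w : X → Z} {S T : Set X} {δ ε : ℝ≥0∞}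
    (h : ∀ a ∈ S, ∀ b ∈ T, edist (u a) (u b) < δ → edist (w a) (w b) ≤ ε)
    (hd : hausdorffEDist (u '' S) (u '' T) < δ) : hausdorffEDist (w '' S) (w '' T) ≤ ε := by
  refine hausdorffEDist_le_of_mem_edist ?_ ?_
  · rintro _ ⟨a, ha, rfl⟩
    obtain ⟨_, ⟨b, hb, rfl⟩, hab⟩ :=
      exists_edist_lt_of_hausdorffEDist_lt (Set.mem_image_of_mem u ha) hd
    exact ⟨_, Set.mem_image_of_mem w hb, h a ha b hb hab⟩
  · rintro _ ⟨b, hb, rfl⟩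
    rw [hausdorffEDist_comm] at hd
    obtain ⟨_, ⟨a, ha, rfl⟩, hab⟩ :=
      exists_edist_lt_of_hausdorffEDist_lt (Set.mem_image_of_mem u hb) hd
    rw [edist_comm] at hab
    exact ⟨_, Set.mem_image_of_mem w ha, by rw [edist_comm]; exact h a ha b hb hab⟩

/-- Regularity of a map in terms of the extended distance. -/
def HasRegularFibres {X X' : Type*} [PseudoEMetricSpace X] [TopologicalSpace X'] (π : X → X') :
    Prop :=
  ∀ (x' : X') (ε : ℝ≥0∞), 0 < ε → ∀ᶠ y' in 𝓝 x',
    hausdorffEDist (π ⁻¹' {x'}) (π ⁻¹' {y'}) < ε ∨ ediam (π ⁻¹' {y'}) < ε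

/-- Fibres are compact and nonempty, so their diameters and Hausdorff distances are finite. The
real-valued quantities therefore carry the same information as the extended ones and do not take the
default value `0` for an infinite distance. -/
theorem IsRegularMap.hasRegularFibres {X X' : Type*} [PseudoMetricSpace X] [TopologicalSpace X']
    [T1Space X'] {π : X → X'} (hπ : IsProperMap π) (hs : Function.Surjective π)
    (h : IsRegularMap π) : HasRegularFibres π := by
  intro x' ε hε
  obtain ⟨δ, hδ0, hδ⟩ : ∃ δ : ℝ, 0 < δ ∧ ENNReal.ofReal δ ≤ ε := by
    rcases eq_or_ne ε ⊤ with rfl | hT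
    · exact ⟨1, one_pos, le_top⟩
    · exact ⟨ε.toReal, ENNReal.toReal_pos hε.ne' hT, ENNReal.ofReal_toReal_le⟩
  obtain ⟨U', hU', hx, hU⟩ := h x' δ hδ0
  have hc : ∀ y, IsCompact (π ⁻¹' {y}) := fun y => hπ.isCompact_preimage isCompact_singleton
  have hn : ∀ y, (π ⁻¹' {y}).Nonempty := fun y => hs y
  filter_upwards [hU'.mem_nhds hx] with y hy
  refine (hU y hy).imp (fun h => ?_) fun h => ?_
  · refine lt_of_lt_of_le ?_ hδ
    rw [← ENNReal.ofReal_toReal (hausdorffEDist_ne_top_of_nonempty_of_bounded (hn x') (hn y)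
      (hc x').isBounded (hc y).isBounded)]
    exact (ENNReal.ofReal_lt_ofReal_iff hδ0).mpr h
  · refine lt_of_lt_of_le ?_ hδ
    rw [← ENNReal.ofReal_toReal (hc y).isBounded.ediam_ne_top]
    exact (ENNReal.ofReal_lt_ofReal_iff hδ0).mpr h

/-- Two continuous functions of which the first separates the points of the fibre of `z` that the
second separates: near the fibre, the first controls the second. -/
theorem exists_fibre_modulus {X X' Y Z : Type*} [TopologicalSpace X] [TopologicalSpace X']
    [PseudoEMetricSpace Y] [PseudoEMetricSpace Z] {π : X → X'} (hπ : IsProperMap π)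
    {u : X → Y} {w : X → Z} (hu : Continuous u) (hw : Continuous w) (z : X')
    (huw : ∀ a b, π a = z → π b = z → edist (u a) (u b) = 0 → edist (w a) (w b) = 0)
    {ε : ℝ≥0∞} (hε : 0 < ε) :
    ∃ δ > 0, ∃ U ∈ 𝓝 z, ∀ a b, π a ∈ U → π b ∈ U → edist (u a) (u b) < δ →
      edist (w a) (w b) < ε := by
  -- An ultrafilter of pairs with both images tending to `z` and with `u`-distance tending to `0`
  -- has, by properness, a limit pair `(a, b)` in the fibre of `z`. There the `u`-distance vanishes,
  -- hence so does the `w`-distance, and continuity of `w` concludes.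
  have key : comap (fun p : X × X => (π p.1, π p.2)) (𝓝 z ×ˢ 𝓝 z) ⊓
      comap (fun p : X × X => (u p.1, u p.2)) (uniformity Y) ≤
      comap (fun p : X × X => (w p.1, w p.2)) (uniformity Z) := by
    rw [le_iff_ultrafilter]
    intro 𝒰 h𝒰
    have h1 := h𝒰.trans inf_le_left
    have h2 := h𝒰.trans inf_le_right
    rw [← map_le_iff_le_comap] at h1 h2 ⊢
    have ha : Tendsto π (𝒰.map Prod.fst : Ultrafilter X) (𝓝 z) := by
      rw [Ultrafilter.coe_map, tendsto_map'_iff]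
      exact tendsto_fst.comp h1
    have hb : Tendsto π (𝒰.map Prod.snd : Ultrafilter X) (𝓝 z) := by
      rw [Ultrafilter.coe_map, tendsto_map'_iff]
      exact tendsto_snd.comp h1
    obtain ⟨a, haz, hca⟩ := hπ.ultrafilter_le_nhds_of_tendsto ha
    obtain ⟨b, hbz, hcb⟩ := hπ.ultrafilter_le_nhds_of_tendsto hb
    have hca : Tendsto Prod.fst (𝒰 : Filter (X × X)) (𝓝 a) := hca
    have hcb : Tendsto Prod.snd (𝒰 : Filter (X × X)) (𝓝 b) := hcb
    have hlim : Tendsto (fun p : X × X => edist (u p.1) (u p.2)) 𝒰 (𝓝 (edist (u a) (u b))) :=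
      (((hu.tendsto a).comp hca).edist ((hu.tendsto b).comp hcb))
    have hzero : Tendsto (fun p : X × X => edist (u p.1) (u p.2)) 𝒰 (𝓝 0) := by
      rw [ENNReal.tendsto_nhds_zero]
      intro η hη
      exact mem_of_superset (h2 (edist_mem_uniformity hη)) fun p hp =>
        show edist (u p.1) (u p.2) ≤ η from le_of_lt hp
    have hw0 := huw a b haz hbz (tendsto_nhds_unique hlim hzero)
    have hlim' : Tendsto (fun p : X × X => edist (w p.1) (w p.2)) 𝒰 (𝓝 0) := by
      rw [← hw0]
      exact (((hw.tendsto a).comp hca).edist ((hw.tendsto b).comp hcb))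
    rw [uniformity_basis_edist.ge_iff]
    intro η hη
    exact hlim' (Iio_mem_nhds hη)
  have hmem : {p : X × X | edist (w p.1) (w p.2) < ε} ∈
      comap (fun p : X × X => (w p.1, w p.2)) (uniformity Z) :=
    ⟨_, edist_mem_uniformity hε, fun _ h => h⟩
  obtain ⟨S, ⟨S', hS', hSS'⟩, T, ⟨T', hT', hTT'⟩, hST⟩ := mem_inf_iff.mp (key hmem)
  obtain ⟨U, hU, hUS⟩ := mem_prod_same_iff.mp hS'
  obtain ⟨δ, hδ, hδT⟩ := mem_uniformity_edist.mp hT'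
  refine ⟨δ, hδ, U, hU, fun a b ha hb hab => ?_⟩
  have : (a, b) ∈ S ∩ T := ⟨hSS' (hUS ⟨ha, hb⟩), hTT' (hδT hab)⟩
  rwa [← hST] at this

/-- `v` maps every fibre of `π₁` bijectively to a fibre of `π₂`. -/
structure FibreBij {X X' Y Y' : Type*} [TopologicalSpace X] [TopologicalSpace X']
    [TopologicalSpace Y] [TopologicalSpace Y'] (π₁ : X → X') (π₂ : Y → Y') (v : X → Y)
    (v' : X' → Y') : Prop where
  continuous : Continuous v
  continuous' : Continuous v'
  bijOn : ∀ z, Set.BijOn v (π₁ ⁻¹' {z}) (π₂ ⁻¹' {v' z})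

/-- The inclusion `X'_π → X'`. -/
abbrev SplitTarget.val {X X' : Type*} {π : X → X'} (y : SplitTarget π) : X' := y.1

/-- The inclusion `X_π → X`. -/
abbrev SplitSource.val {X X' : Type*} {π : X → X'} (x : SplitSource π) : X := x.1

/-- A point with more than one preimage, as a point of `X'_π`. -/
abbrev SplitTarget.mk {X X' : Type*} {π : X → X'} (y : X') (h : (π ⁻¹' {y}).Nontrivial) :
    SplitTarget π := ⟨y, h⟩

/-- A point of `X_π`. -/
abbrev SplitSource.mk {X X' : Type*} {π : X → X'} (x : X) (h : (π ⁻¹' {π x}).Nontrivial) :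
    SplitSource π := ⟨x, h⟩

theorem SplitTarget.val_injective {X X' : Type*} {π : X → X'} :
    Function.Injective (SplitTarget.val (π := π)) := Subtype.val_injective

theorem SplitSource.val_injective {X X' : Type*} {π : X → X'} :
    Function.Injective (SplitSource.val (π := π)) := Subtype.val_injective

theorem surjective_splitMap {X X' : Type*} {π : X → X'} : Function.Surjective (splitMap π) := by
  rintro ⟨y, hy⟩
  obtain ⟨x, hx⟩ := hy.nonempty
  obtain rfl : π x = y := hx
  exact ⟨⟨x, hy⟩, rfl⟩

/-! ### The topology of the split spaces `X'_π` and `X_π`. -/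

section Topology

theorem eq_of_edist_zero {X : Type*} [PseudoEMetricSpace X] [T0Space X] {a b : X}
    (h : edist a b = 0) : a = b :=
  (EMetric.inseparable_iff.mpr h).eq

/-- Moving a set by less than `η` in the Hausdorff metric lowers its diameter by at most `2 * η`;
this loss is fitted into the gap above `δ`. -/
theorem isOpen_splitTarget_ediam {X X' : Type*} [PseudoEMetricSpace X] {π : X → X'} (δ : ℝ≥0∞) :
    IsOpen {y : SplitTarget π | δ < ediam (π ⁻¹' {y.1})} := by
  rw [EMetric.isOpen_iff]
  intro y hy
  obtain ⟨η, hη, hlt⟩ : ∃ η > 0, δ + 2 * η < ediam (π ⁻¹' {y.1}) := by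
    obtain ⟨ζ, hζ, h⟩ := ENNReal.lt_iff_exists_add_pos_lt.mp hy
    refine ⟨(ζ : ℝ≥0∞) / 2, by simpa using hζ.ne', ?_⟩
    rwa [ENNReal.mul_div_cancel two_ne_zero ENNReal.ofNat_ne_top]
  refine ⟨η, hη, fun y' hy' => ?_⟩
  have hy' : edist y' y < η := hy'
  rw [edist_comm] at hy'
  have h := ediam_le_ediam_add_hausdorffEDist (show hausdorffEDist _ _ < η from hy')
  have := hlt.trans_le h
  exact lt_of_add_lt_add_right this

theorem ediam_fibre_pos {X X' : Type*} [PseudoEMetricSpace X] {π : X → X'} [T0Space X]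
    (y : SplitTarget π) : 0 < ediam (π ⁻¹' {y.1}) := by
  obtain ⟨a, ha, b, hb, hab⟩ := y.2
  refine lt_of_lt_of_le ?_ (edist_le_ediam_of_mem ha hb)
  exact pos_iff_ne_zero.mpr fun h => hab (eq_of_edist_zero h)

variable {X X' : Type*} [PseudoEMetricSpace X] [TopologicalSpace X'] {π : X → X'}

/-- Fix one point `a` of the fibre of `y`. A fibre close to that of `y` contains a point close to
`a`, and continuity of `π` at `a` suffices. -/
theorem continuous_splitTarget_val (hπ : Continuous π) :
    Continuous (SplitTarget.val : SplitTarget π → X') := by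
  rw [continuous_iff_continuousAt]
  intro y U hU
  obtain ⟨a, ha⟩ := y.2.nonempty
  have ha : π a = y.1 := ha
  obtain ⟨ε, hε, hU'⟩ := EMetric.mem_nhds_iff.mp (hπ.continuousAt (x := a) (by rwa [ha]))
  refine EMetric.mem_nhds_iff.mpr ⟨ε, hε, fun y' hy' => ?_⟩
  have hy' : edist y' y < ε := hy'
  rw [edist_comm] at hy'
  obtain ⟨b, hb, hab⟩ := exists_edist_lt_of_hausdorffEDist_lt
    (s := π ⁻¹' {y.1}) (t := π ⁻¹' {y'.1}) ha hy'
  rw [edist_comm] at hab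
  have : π b ∈ U := hU' hab
  rwa [show π b = y'.1 from hb] at this

theorem t2Space_splitTarget [T2Space X'] (hπ : Continuous π) : T2Space (SplitTarget π) :=
  .of_injective_continuous SplitTarget.val_injective (continuous_splitTarget_val hπ)

/-- The split points of a compact set whose fibres are not small form a compact set. -/
theorem isCompact_splitTarget [T2Space X'] (hreg : HasRegularFibres π) {C : Set X'}
    (hC : IsCompact C) {ε : ℝ≥0∞} (hε : 0 < ε) :
    IsCompact {y : SplitTarget π | ε ≤ ediam (π ⁻¹' {y.1}) ∧ y.1 ∈ C} := by
  rw [isCompact_iff_ultrafilter_le_nhds]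
  intro 𝒰 h𝒰
  rw [le_principal_iff] at h𝒰
  obtain ⟨x', hx'C, hx'⟩ := isCompact_iff_ultrafilter_le_nhds.mp hC (𝒰.map SplitTarget.val) (by
    rw [le_principal_iff, Ultrafilter.coe_map, mem_map]
    exact mem_of_superset h𝒰 fun y hy => hy.2)
  have hx' : Tendsto SplitTarget.val (𝒰 : Filter (SplitTarget π)) (𝓝 x') := hx'
  -- Regularity is applied with `min η ε`: the diameters along the ultrafilter are at least `ε`, so
  -- only the Hausdorff alternative remains.
  have hd : ∀ η : ℝ≥0∞, 0 < η → ∀ᶠ y : SplitTarget π in 𝒰,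
      hausdorffEDist (π ⁻¹' {x'}) (π ⁻¹' {y.1}) < η := by
    intro η hη
    filter_upwards [hx'.eventually (hreg x' (min η ε) (lt_min hη hε)), h𝒰] with y hy hyε
    rcases hy with hy | hy
    · exact hy.trans_le (min_le_left _ _)
    · exact absurd (hy.trans_le (min_le_right _ _)) (not_lt.mpr hyε.1)
  -- The bound on the diameter survives in the limit; since `ε > 0`, the limit point is again a
  -- split point.
  have hx'ε : ε ≤ ediam (π ⁻¹' {x'}) := by
    refine ENNReal.le_of_forall_pos_le_add fun η hη _ => ?_
    have hη' : (0 : ℝ≥0∞) < η / 2 := by simpa using hη.ne'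
    obtain ⟨y, hy, hyε⟩ := ((hd _ hη').and h𝒰).exists
    rw [hausdorffEDist_comm] at hy
    have := ediam_le_ediam_add_hausdorffEDist hy
    rw [ENNReal.mul_div_cancel two_ne_zero ENNReal.ofNat_ne_top] at this
    exact hyε.1.trans this
  have hnt : (π ⁻¹' {x'}).Nontrivial := by
    rw [← Set.not_subsingleton_iff]
    intro h
    rw [ediam_subsingleton h] at hx'ε
    exact absurd hε (not_lt.mpr hx'ε)
  refine ⟨SplitTarget.mk x' hnt, ⟨hx'ε, hx'C⟩, ?_⟩
  rw [nhds_basis_eball.ge_iff]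
  intro η hη
  filter_upwards [hd η hη] with y hy
  change edist y (SplitTarget.mk x' hnt) < η
  rw [edist_comm]
  exact hy

/-- Choose `ε` strictly between `0` and the diameter of the fibre at `y`. The compact set for `ε` is
then a neighbourhood of `y`, because having larger diameter than `ε` is an open condition. -/
theorem weaklyLocallyCompactSpace_splitTarget [T0Space X] [T2Space X']
    [WeaklyLocallyCompactSpace X'] (hπ : Continuous π) (hreg : HasRegularFibres π) :
    WeaklyLocallyCompactSpace (SplitTarget π) := by
  refine ⟨fun y => ?_⟩
  obtain ⟨C, hC, hy⟩ := exists_compact_mem_nhds y.1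
  obtain ⟨ε, hε, hεy⟩ := exists_between (ediam_fibre_pos y)
  refine ⟨_, isCompact_splitTarget hreg hC hε, ?_⟩
  filter_upwards [(isOpen_splitTarget_ediam ε).mem_nhds hεy,
    (continuous_splitTarget_val hπ).continuousAt.preimage_mem_nhds hy] with z hz hzC
  exact ⟨le_of_lt hz, hzC⟩

/-- Every split fibre has positive diameter, so the bounds `1 / n`, together with a compact
exhaustion of `X'`, reach all split points. -/
theorem sigmaCompactSpace_splitTarget [T0Space X] [T2Space X'] [SigmaCompactSpace X']
    (hreg : HasRegularFibres π) : SigmaCompactSpace (SplitTarget π) := by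
  refine SigmaCompactSpace_iff_exists_compact_covering.mpr ⟨fun n =>
    {y | (n : ℝ≥0∞)⁻¹ ≤ ediam (π ⁻¹' {y.1}) ∧ y.1 ∈ compactCovering X' n}, fun n =>
    isCompact_splitTarget hreg (isCompact_compactCovering X' n)
      (ENNReal.inv_pos.mpr (ENNReal.natCast_ne_top n)), ?_⟩
  rw [Set.eq_univ_iff_forall]
  intro y
  obtain ⟨n, hn⟩ := ENNReal.exists_inv_nat_lt (ediam_fibre_pos y).ne'
  obtain ⟨m, hm⟩ := exists_mem_compactCovering y.1
  refine Set.mem_iUnion.mpr ⟨max n m, ?_, compactCovering_subset X' (le_max_right n m) hm⟩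
  refine le_trans (ENNReal.inv_le_inv.mpr ?_) hn.le
  exact_mod_cast le_max_left n m

/-- The sum metric induces the topology of the fibre product of `X` and `X'_π` over `X'`. Continuity
into `X_π` can thus be checked on the two coordinates. -/
theorem isInducing_splitSource {X X' : Type*} [PseudoEMetricSpace X] {π : X → X'} :
    IsInducing fun x : SplitSource π => (x.val, splitMap π x) := by
  rw [isInducing_iff_nhds]
  intro x
  refine le_antisymm ?_ ?_
  · rw [← map_le_iff_le_comap]
    have h1 : Continuous (SplitSource.val : SplitSource π → X) :=
      (LipschitzWith.of_edist_le fun a b =>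
        le_self_add (a := edist a.1 b.1) (b := edist (splitMap π a) (splitMap π b))).continuous
    have h2 : Continuous (splitMap π) :=
      (LipschitzWith.of_edist_le fun a b =>
        le_add_self (a := edist (splitMap π a) (splitMap π b)) (b := edist a.1 b.1)).continuous
    exact (h1.prodMk h2).continuousAt
  · rw [nhds_basis_eball.ge_iff]
    intro ε hε
    have hε2 : 0 < ε / 2 := by simpa using hε.ne'
    refine ⟨Metric.eball x.1 (ε / 2) ×ˢ Metric.eball (splitMap π x) (ε / 2),
      prod_mem_nhds (eball_mem_nhds _ hε2) (eball_mem_nhds _ hε2), ?_⟩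
    rintro y ⟨h1, h2⟩
    change edist y.1 x.1 + edist (splitMap π y) (splitMap π x) < ε
    rw [← ENNReal.add_halves ε]
    exact ENNReal.add_lt_add h1 h2

theorem continuous_splitSource_val {X X' : Type*} [PseudoEMetricSpace X] {π : X → X'} :
    Continuous (SplitSource.val : SplitSource π → X) :=
  continuous_fst.comp isInducing_splitSource.continuous

theorem continuous_splitMap {X X' : Type*} [PseudoEMetricSpace X] {π : X → X'} :
    Continuous (splitMap π) :=
  continuous_snd.comp isInducing_splitSource.continuous

/-- This is base change of a proper map along `X'_π → X'`: properness of `π` provides the limit in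
`X`, and the convergence in `X'_π` is given. -/
theorem isProperMap_splitMap (hπ : IsProperMap π) : IsProperMap (splitMap π) := by
  rw [isProperMap_iff_ultrafilter]
  refine ⟨continuous_splitMap, fun 𝒰 y hy => ?_⟩
  have h1 : Tendsto π (𝒰.map SplitSource.val : Ultrafilter X) (𝓝 y.val) := by
    rw [Ultrafilter.coe_map, tendsto_map'_iff]
    exact ((continuous_splitTarget_val hπ.continuous).tendsto y).comp hy
  obtain ⟨x, hxy, hx⟩ := hπ.ultrafilter_le_nhds_of_tendsto h1
  refine ⟨SplitSource.mk x (hxy ▸ y.2), Subtype.ext hxy, ?_⟩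
  rw [isInducing_splitSource.nhds_eq_comap, ← map_le_iff_le_comap]
  refine Tendsto.prodMk_nhds hx ?_
  rwa [show splitMap π (SplitSource.mk x (hxy ▸ y.2)) = y from Subtype.ext hxy]

theorem t2Space_splitSource {X X' : Type*} [PseudoEMetricSpace X] {π : X → X'} [T2Space X] :
    T2Space (SplitSource π) :=
  .of_injective_continuous SplitSource.val_injective continuous_splitSource_val

end Topology

/-! ### Comparison of split spaces along fibrewise bijections. -/

section Compare

variable {X X' Y Y' : Type*} [PseudoEMetricSpace X] [TopologicalSpace X']
  [PseudoEMetricSpace Y] [TopologicalSpace Y'] {π₁ : X → X'} {π₂ : Y → Y'} {v : X → Y}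
  {v' : X' → Y'}

theorem FibreBij.nontrivial_iff (h : FibreBij π₁ π₂ v v') (z : X') :
    (π₂ ⁻¹' {v' z}).Nontrivial ↔ (π₁ ⁻¹' {z}).Nontrivial := by
  rw [← (h.bijOn z).image_eq]
  exact (h.bijOn z).injOn.image_nontrivial_iff

/-- The map of the split points given by a map which is bijective on fibres. -/
def FibreBij.splitTargetMap (h : FibreBij π₁ π₂ v v') (z : SplitTarget π₁) : SplitTarget π₂ :=
  ⟨v' z.1, (h.nontrivial_iff z.1).mpr z.2⟩

/-- Injectivity of `v` on the fibre of `z` makes `v`-distance control distance near that fibre. A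
small Hausdorff distance or diameter of the image fibres therefore passes back to the fibres
themselves. -/
theorem FibreBij.hasRegularFibres [T0Space Y] (h : FibreBij π₁ π₂ v v') (hπ : IsProperMap π₁)
    (hreg : HasRegularFibres π₂) : HasRegularFibres π₁ := by
  intro z ε hε
  obtain ⟨ε', hε', hlt⟩ := exists_between hε
  obtain ⟨δ, hδ, U, hU, hUδ⟩ := exists_fibre_modulus hπ h.continuous continuous_id z
    (fun a b ha hb hab => by
      rw [(h.bijOn z).injOn ha hb (eq_of_edist_zero hab)]; exact edist_self _) hε'
  filter_upwards [hU, (h.continuous'.tendsto z).eventually (hreg (v' z) δ hδ)] with y hy hyd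
  refine hyd.imp (fun hd => lt_of_le_of_lt ?_ hlt) fun hd => lt_of_le_of_lt ?_ hlt
  · rw [← (h.bijOn z).image_eq, ← (h.bijOn y).image_eq] at hd
    have := hausdorffEDist_image_le (w := id) (ε := ε') (fun a ha b hb hab => ?_) hd
    · simpa using this
    · have ha : π₁ a = z := ha
      have hb : π₁ b = y := hb
      exact (hUδ a b (by rw [ha]; exact mem_of_mem_nhds hU) (by rwa [hb]) hab).le
  · refine ediam_le fun a ha b hb => ?_
    have hab := (edist_le_ediam_of_mem ((h.bijOn y).mapsTo ha) ((h.bijOn y).mapsTo hb)).trans_lt hd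
    have ha : π₁ a = y := ha
    have hb : π₁ b = y := hb
    exact (hUδ a b (by rwa [ha]) (by rwa [hb]) hab).le

/-- Near the fibre of `z`, distances in `X` control `v`-distances by continuity and conversely by
injectivity on the fibre. The converse holds only for fibres over a neighbourhood of `z` in `X'`,
which is what the first coordinate supplies. -/
theorem FibreBij.isInducing [T0Space Y] (h : FibreBij π₁ π₂ v v') (hπ : IsProperMap π₁) :
    IsInducing fun z : SplitTarget π₁ => (z.val, h.splitTargetMap z) := by
  rw [isInducing_iff_nhds]
  intro z
  refine le_antisymm ?_ ?_
  · rw [← map_le_iff_le_comap]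
    refine (continuous_splitTarget_val hπ.continuous).continuousAt.prodMk_nhds ?_
    rw [nhds_basis_eball.tendsto_right_iff]
    intro ε hε
    obtain ⟨ε', hε', hlt⟩ := exists_between hε
    obtain ⟨δ, hδ, U, hU, hUδ⟩ := exists_fibre_modulus hπ continuous_id h.continuous z.1
      (fun a b _ _ hab => EMetric.inseparable_iff.mp
        ((EMetric.inseparable_iff.mpr hab).map h.continuous)) hε'
    filter_upwards [(continuous_splitTarget_val hπ.continuous).continuousAt.preimage_mem_nhds hU,
      eball_mem_nhds z hδ] with y hyU hyδ
    have hyδ : hausdorffEDist (π₁ ⁻¹' {y.1}) (π₁ ⁻¹' {z.1}) < δ := hyδ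
    change hausdorffEDist (π₂ ⁻¹' {v' y.1}) (π₂ ⁻¹' {v' z.1}) < ε
    refine lt_of_le_of_lt ?_ hlt
    rw [← (h.bijOn z.1).image_eq, ← (h.bijOn y.1).image_eq]
    refine hausdorffEDist_image_le (u := id) (δ := δ) (fun a ha b hb hab => ?_) (by simpa using hyδ)
    have ha : π₁ a = y.1 := ha
    have hb : π₁ b = z.1 := hb
    exact (hUδ a b (by rwa [ha]) (by rw [hb]; exact mem_of_mem_nhds hU) hab).le
  · rw [nhds_basis_eball.ge_iff]
    intro ε hε
    obtain ⟨ε', hε', hlt⟩ := exists_between hε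
    obtain ⟨δ, hδ, U, hU, hUδ⟩ := exists_fibre_modulus hπ h.continuous continuous_id z.1
      (fun a b ha hb hab => by
        rw [(h.bijOn z.1).injOn ha hb (eq_of_edist_zero hab)]; exact edist_self _) hε'
    refine ⟨U ×ˢ eball (h.splitTargetMap z) δ, prod_mem_nhds hU (eball_mem_nhds _ hδ), ?_⟩
    rintro y ⟨hyU, hyδ⟩
    have hyδ : hausdorffEDist (π₂ ⁻¹' {v' y.1}) (π₂ ⁻¹' {v' z.1}) < δ := hyδ
    change hausdorffEDist (π₁ ⁻¹' {y.1}) (π₁ ⁻¹' {z.1}) < ε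
    refine lt_of_le_of_lt ?_ hlt
    rw [← (h.bijOn z.1).image_eq, ← (h.bijOn y.1).image_eq] at hyδ
    have := hausdorffEDist_image_le (w := id) (ε := ε') (fun a ha b hb hab => ?_) hyδ
    · simpa using this
    · have ha : π₁ a = y.1 := ha
      have hb : π₁ b = z.1 := hb
      exact (hUδ a b (by rwa [ha]) (by rw [hb]; exact mem_of_mem_nhds hU) hab).le

theorem FibreBij.continuous_splitTargetMap [T0Space Y] (h : FibreBij π₁ π₂ v v')
    (hπ : IsProperMap π₁) : Continuous h.splitTargetMap :=
  continuous_snd.comp (h.isInducing hπ).continuous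

end Compare

end RegularFibres

/-! ### An étale criterion, and lifting along a factor map. -/

section SplitGroupoids

open GroupoidStr Filter

/-- A groupoid which injects onto an invariant part of an étale groupoid is étale for a finer
topology which is determined by the one of the unit space. -/
theorem isEtale_of_isInducing {H K : Type*} [GroupoidStr H] [TopologicalSpace H]
    [SecondCountableTopology H] [LocallyCompactSpace H] [T2Space H] [GroupoidStr K]
    [TopologicalSpace K] [IsEtale K] (ι : H → K) (hι : Function.Injective ι)
    (hr : ∀ h, ι (r h) = r (ι h)) (hs : ∀ h, ι (s h) = s (ι h))
    (hmul : ∀ (g h : H) (e : s g = r h),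
      ι (mul g h e) = mul (ι g) (ι h) ((hs g).symm.trans ((congrArg ι e).trans (hr h))))
    (hsat : ∀ (k : K) (x : H), r k = ι x → k ∈ Set.range ι)
    (hind : IsInducing fun h => (ι h, r h)) (hinv : Continuous (inv : H → H)) : IsEtale H := by
  have hcι : Continuous ι := continuous_fst.comp hind.continuous
  have hcr : Continuous (r : H → H) := continuous_snd.comp hind.continuous
  have hcr' : Continuous (rangeUnit : H → UnitSpace H) := hcr.subtype_mk _
  have hrK : IsOpenMap (rangeUnit : K → UnitSpace K) := IsEtale.isLocalHomeomorph_range.isOpenMap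
  let j : UnitSpace H → UnitSpace K := fun x => ⟨ι x.1, by rw [← hr, x.2]⟩
  have hj : Continuous j := (hcι.comp continuous_subtype_val).subtype_mk _
  have hjr : ∀ h : H, j (rangeUnit h) = rangeUnit (ι h) := fun h => Subtype.ext (hr h)
  refine ⟨inferInstance, inferInstance, inferInstance, ?_, hinv, ?_⟩
  · rw [hind.continuous_iff]
    refine Continuous.prodMk ?_ ?_
    · refine Continuous.congr ?_ fun p => (hmul p.1.1 p.1.2 p.2).symm
      exact (IsEtale.continuous_mul (G := K)).comp (Continuous.subtype_mk
        ((hcι.comp (continuous_fst.comp continuous_subtype_val)).prodMk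
          (hcι.comp (continuous_snd.comp continuous_subtype_val)))
        fun p => (hs p.1.1).symm.trans ((congrArg ι p.2).trans (hr p.1.2)))
    · exact (hcr.comp (continuous_fst.comp continuous_subtype_val)).congr
        fun p => (r_mul p.1.1 p.1.2 p.2).symm
  · refine isLocalHomeomorph_of_locallyInjective hcr' ?_ fun h => ?_
    · rw [isOpenMap_iff_nhds_le]
      intro h W hW
      rw [mem_map, hind.nhds_eq_comap, nhds_prod_eq] at hW
      obtain ⟨T, hT, hTW⟩ := hW
      obtain ⟨U, hU, V, hV, hUV⟩ := mem_prod_iff.mp hT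
      have h1 : j ⁻¹' (rangeUnit '' U) ∈ 𝓝 (rangeUnit h) := by
        refine hj.continuousAt.preimage_mem_nhds ?_
        rw [hjr]
        exact hrK.image_mem_nhds hU
      have h2 : (Subtype.val : UnitSpace H → H) ⁻¹' V ∈ 𝓝 (rangeUnit h) :=
        continuous_subtype_val.continuousAt.preimage_mem_nhds hV
      -- Openness in `K` yields `k` near `ι h` with range `ι x`, and saturation puts it into `H` as
      -- some `g`. As `r g = x` is near `r h`, both coordinates of the inducing map show that `g` is
      -- near `h`.
      filter_upwards [h1, h2] with x ⟨k, hkU, hk⟩ hxV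
      have hk : r k = ι x.1 := congrArg Subtype.val hk
      obtain ⟨g, rfl⟩ := hsat k x.1 hk
      have hgx : r g = x.1 := hι (by rw [hr, hk])
      have : g ∈ rangeUnit ⁻¹' W := hTW (hUV ⟨hkU, show r g ∈ V from hgx ▸ hxV⟩)
      rwa [Set.mem_preimage, show rangeUnit g = x from Subtype.ext hgx] at this
    · obtain ⟨U, hU, hx, hi⟩ :=
        (IsEtale.isLocalHomeomorph_range (G := K)).isLocallyInjective (ι h)
      refine ⟨ι ⁻¹' U, hU.preimage hcι, hx, fun a ha b hb hab => hι (hi ha hb ?_)⟩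
      rw [← hjr, ← hjr, hab]

variable {G G' : Type u} [GroupoidStr G] [GroupoidStr G']

section Fibres

variable [TopologicalSpace G] [TopologicalSpace G'] (π : G → G') [IsFactorMap π]

theorem eq_of_map_eq_of_r {a b : G} (h : π a = π b) (hr : r a = r b) : a = b :=
  (IsFactorMap.bijOn (π := π) (r a) (r_r a)).injOn rfl hr.symm h

theorem eq_of_map_eq_of_s {a b : G} (h : π a = π b) (hs : s a = s b) : a = b := by
  rw [← inv_inv a, ← inv_inv b]
  refine congrArg inv (eq_of_map_eq_of_r π ?_ ?_)
  · rw [map_inv π, map_inv π, h]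
  · rw [r_inv, r_inv, hs]

theorem exists_map_eq_of_r {x : G} {z : G'} (h : π x = r z) : ∃ a, π a = z ∧ r a = x := by
  have hx : r x = x := eq_r_of_map_unit π (by rw [h, r_r])
  obtain ⟨a, ha, haz⟩ := (IsFactorMap.bijOn (π := π) x hx).surjOn (show r z = π x from h.symm)
  exact ⟨a, haz, ha⟩

theorem exists_map_eq_of_s {x : G} {z : G'} (h : π x = s z) : ∃ a, π a = z ∧ s a = x := by
  obtain ⟨a, ha, hax⟩ := exists_map_eq_of_r π (h.trans (r_inv z).symm)
  exact ⟨inv a, by rw [map_inv π, ha, inv_inv], by rw [s_inv, hax]⟩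

/-- Every element of `G` above a unit is itself a unit, so passing to the unit space loses no point
of the fibre. -/
theorem fibreBij_pt : FibreBij (strMap π 0) π (fun x => x.pt.1) (fun x => x.pt.1) where
  continuous := continuous_subtype_val
  continuous' := continuous_subtype_val
  bijOn z := by
    refine ⟨fun x hx => congrArg (fun y : Str G' 0 => y.pt.1) hx, fun x _ y _ h => Subtype.ext h,
      fun a ha => ?_⟩
    have ha : π a = z.pt.1 := ha
    exact ⟨⟨a, eq_r_of_map_unit π (by rw [ha, z.pt.2])⟩, Subtype.ext ha, rfl⟩

/-- Consecutive entries share a unit, and a lift of an element is determined by its range as well as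
by its source. Agreement therefore propagates along the string in both directions. -/
theorem arr_eq_iff_of_strMap_eq {n : ℕ} {g h : Str G (n + 1)}
    (e : strMap π (n + 1) g = strMap π (n + 1) h) (k : Fin (n + 1)) :
    g.arr k = h.arr k ↔ g.arr 0 = h.arr 0 := by
  have e' : ∀ k, π (g.arr k) = π (h.arr k) := fun k =>
    congrArg (fun a : Str G' (n + 1) => a.arr k) e
  induction k using Fin.induction with
  | zero => exact Iff.rfl
  | succ k ih =>
    refine Iff.trans ?_ ih
    refine ⟨fun hk => eq_of_map_eq_of_s π (e' _) ?_, fun hk => eq_of_map_eq_of_r π (e' _) ?_⟩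
    · rw [g.comp, h.comp, hk]
    · rw [← g.comp, ← h.comp, hk]

theorem exists_strMap_eq_of_arr {n : ℕ} (z : Str G' (n + 1)) (k : Fin (n + 1)) :
    ∀ a : G, π a = z.arr k → ∃ g : Str G (n + 1), strMap π (n + 1) g = z ∧ g.arr k = a := by
  induction k using Fin.induction with
  | zero =>
    intro a ha
    obtain ⟨g, hg, hga⟩ := exists_strMap_eq_of_firstVertex π (n + 1) z (rangeUnit a)
      (by rw [unitMap_rangeUnit, ha]; rfl)
    refine ⟨g, hg, eq_of_map_eq_of_r π ?_ (congrArg Subtype.val hga)⟩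
    rw [← strMap_arr π, hg, ha]
  | succ k ih =>
    intro a ha
    -- Step back to the preceding entry by lifting it to some `b` composable with `a`. The string
    -- through `b` then has `a` as its next entry, by uniqueness of the lift with given range.
    obtain ⟨b, hb, hba⟩ := exists_map_eq_of_s π (x := r a) (z := z.arr k.castSucc)
      (by rw [IsFactorMap.map_r (π := π), ha, z.comp])
    obtain ⟨g, hg, hgb⟩ := ih b hb
    refine ⟨g, hg, eq_of_map_eq_of_r π ?_ ?_⟩
    · rw [← strMap_arr π, hg, ha]
    · rw [← g.comp, hgb, hba]

/-- A lift of any single entry extends uniquely to a lift of the whole string. Hence fibres of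
`π⁽ⁿ⁾` are fibres of `π`, which carries regularity and the split topology over to strings. -/
theorem fibreBij_arr (n : ℕ) (k : Fin (n + 1)) :
    FibreBij (strMap π (n + 1)) π (fun g => g.arr k) (fun g => g.arr k) where
  continuous := continuous_arr n k
  continuous' := continuous_arr n k
  bijOn z := by
    refine ⟨fun g hg => ?_, fun g hg h hh hgh => ?_, fun a ha => exists_strMap_eq_of_arr π z k a ha⟩
    · have hg : strMap π (n + 1) g = z := hg
      change π (g.arr k) = z.arr k
      rw [← strMap_arr π, hg]
    · have e : strMap π (n + 1) g = strMap π (n + 1) h := Eq.trans hg (Eq.symm hh)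
      have h0 := (arr_eq_iff_of_strMap_eq π e k).mp hgh
      exact Str.ext fun j => (arr_eq_iff_of_strMap_eq π e j).mpr h0

variable [IsEtale G] [IsEtale G']

theorem fibreBij_r : FibreBij π π r r where
  continuous := continuous_r
  continuous' := continuous_r
  bijOn z := by
    refine ⟨fun a ha => ?_, fun a ha b hb hab => eq_of_map_eq_of_r π (Eq.trans ha (Eq.symm hb)) hab,
      fun x hx => exists_map_eq_of_r π hx⟩
    have ha : π a = z := ha
    change π (r a) = r z
    rw [IsFactorMap.map_r (π := π), ha]

theorem fibreBij_inv : FibreBij π π inv inv where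
  continuous := IsEtale.continuous_inv
  continuous' := IsEtale.continuous_inv
  bijOn z := by
    refine ⟨fun a ha => ?_, fun a _ b _ hab => ?_, fun x hx => ⟨inv x, ?_, inv_inv x⟩⟩
    · have ha : π a = z := ha
      change π (inv a) = inv z
      rw [map_inv π, ha]
    · rw [← inv_inv a, hab, inv_inv]
    · have hx : π x = inv z := hx
      change π (inv x) = z
      rw [map_inv π, hx, inv_inv]

end Fibres

variable [MetricSpace G] [MetricSpace G'] (π : G → G') [IsFactorMap π]

theorem isFactorMap_splitMap : IsFactorMap (splitMap π) where
  map_r g := Subtype.ext (IsFactorMap.map_r (π := π) g.1)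
  map_s g := Subtype.ext (IsFactorMap.map_s (π := π) g.1)
  map_mul g h e := Subtype.ext (IsFactorMap.map_mul (π := π) g.1 h.1 (congrArg Subtype.val e))
  surjective := surjective_splitMap
  isProperMap := isProperMap_splitMap (IsFactorMap.isProperMap (π := π))
  bijOn x hx := by
    refine ⟨fun g hg => ?_, fun g hg h hh hgh => ?_, fun z hz => ?_⟩
    · have hg : r g = x := hg
      rw [← hg]
      exact Subtype.ext (IsFactorMap.map_r (π := π) g.1).symm
    · exact SplitSource.val_injective (eq_of_map_eq_of_r π (congrArg SplitTarget.val hgh)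
        (congrArg SplitSource.val (Eq.trans hg (Eq.symm hh))))
    · have hz : r z = splitMap π x := hz
      obtain ⟨a, ha, hax⟩ := exists_map_eq_of_r π (x := x.1) (z := z.1)
        (congrArg SplitTarget.val hz).symm
      exact ⟨SplitSource.mk a (ha ▸ z.2), SplitSource.val_injective hax,
        SplitTarget.val_injective ha⟩

/-! ### Étale structure of `G_π` and `G'_π`, and their composable strings. -/

theorem continuous_targetIncl : (n : ℕ) → Continuous (targetIncl π n)
  | 0 => ((continuous_splitTarget_val (IsFactorMap.isProperMap (π := π)).continuous).comp
      continuous_subtype_val).subtype_mk _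
  | n + 1 => by
    rw [(isEmbedding_arr n).continuous_iff, continuous_pi_iff]
    exact fun k => (continuous_splitTarget_val (IsFactorMap.isProperMap (π := π)).continuous).comp
      (continuous_arr n k)

theorem continuous_sourceIncl : (n : ℕ) → Continuous (sourceIncl π n)
  | 0 => (continuous_splitSource_val.comp continuous_subtype_val).subtype_mk _
  | n + 1 => by
    rw [(isEmbedding_arr n).continuous_iff, continuous_pi_iff]
    exact fun k => continuous_splitSource_val.comp (continuous_arr n k)

theorem targetIncl_injective : (n : ℕ) → Function.Injective (targetIncl π n)
  | 0 => fun _ _ h => Subtype.ext (SplitTarget.val_injective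
      (congrArg (fun a : Str G' 0 => a.pt.1) h))
  | n + 1 => fun _ _ h => Str.ext fun k =>
      SplitTarget.val_injective (congrArg (fun a : Str G' (n + 1) => a.arr k) h)

theorem sourceIncl_injective : (n : ℕ) → Function.Injective (sourceIncl π n)
  | 0 => fun _ _ h => Subtype.ext (SplitSource.val_injective
      (congrArg (fun a : Str G 0 => a.pt.1) h))
  | n + 1 => fun _ _ h => Str.ext fun k =>
      SplitSource.val_injective (congrArg (fun a : Str G (n + 1) => a.arr k) h)

section

variable [IsFactorMap (splitMap π)]

theorem strMap_sourceIncl : (n : ℕ) → (x : Str (SplitSource π) n) →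
    strMap π n (sourceIncl π n x) = targetIncl π n (strMap (splitMap π) n x)
  | 0, _ => rfl
  | _ + 1, _ => rfl

theorem splitMap_strSource (n : ℕ) (x : Str (SplitSource π) n) :
    splitMap (strMap π n) (strSource π n x) = strTarget π n (strMap (splitMap π) n x) :=
  SplitTarget.val_injective (strMap_sourceIncl π n x)

end

variable [IsEtale G] [IsEtale G']

theorem hasRegularFibres_strMap (hreg : HasRegularFibres π) :
    (n : ℕ) → HasRegularFibres (strMap π n)
  | 0 => (fibreBij_pt π).hasRegularFibres (isProperMap_strMap π 0) hreg
  | n + 1 => (fibreBij_arr π n 0).hasRegularFibres (isProperMap_strMap π (n + 1)) hreg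

/-- This is the hypothesis of `isEtale_of_isInducing`: the finer topology of `G'_π` is recovered
from that of `G'` and from the one on its units. -/
theorem isInducing_splitTarget_r : IsInducing fun z : SplitTarget π => (z.val, r z) :=
  (fibreBij_r π).isInducing IsFactorMap.isProperMap

theorem continuous_inv_splitTarget : Continuous (inv : SplitTarget π → SplitTarget π) :=
  (fibreBij_inv π).continuous_splitTargetMap IsFactorMap.isProperMap

theorem isInducing_splitSource_r : IsInducing fun x : SplitSource π => (x.val, r x) := by
  have h1 : IsInducing fun x : SplitSource π => (x.val, ((splitMap π x).val, r (splitMap π x))) :=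
    (IsInducing.id.prodMap (isInducing_splitTarget_r π)).comp isInducing_splitSource
  have hrm : ∀ x : SplitSource π, r (splitMap π x) = splitMap π (r x) := fun x =>
    Subtype.ext (IsFactorMap.map_r (π := π) x.1).symm
  have hcr : Continuous (r : SplitSource π → SplitSource π) := by
    rw [isInducing_splitSource.continuous_iff]
    refine ((continuous_r (G := G)).comp continuous_splitSource_val).prodMk ?_
    refine Continuous.congr ?_ hrm
    exact (continuous_snd.comp (isInducing_splitTarget_r π).continuous).comp continuous_splitMap
  -- The inducing data `x`, `π x`, `r (splitMap π x)` depend continuously on `x` and `r x`, since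
  -- `splitMap π` commutes with the range. Hence the pair `(x, r x)` is already inducing.
  refine IsInducing.of_comp (continuous_splitSource_val.prodMk hcr)
    (g := fun p : G × SplitSource π => (p.1, (π p.1, splitMap π p.2))) ?_ ?_
  · exact continuous_fst.prodMk (((IsFactorMap.isProperMap (π := π)).continuous.comp
      continuous_fst).prodMk (continuous_splitMap.comp continuous_snd))
  · convert h1 using 1
    funext x
    exact congrArg (fun t => (x.val, (π x.1, t))) (hrm x).symm

theorem continuous_inv_splitSource : Continuous (inv : SplitSource π → SplitSource π) := by
  rw [isInducing_splitSource.continuous_iff]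
  refine ((IsEtale.continuous_inv (G := G)).comp continuous_splitSource_val).prodMk ?_
  exact ((continuous_inv_splitTarget π).comp continuous_splitMap).congr fun x =>
    Subtype.ext (map_inv π x.1).symm

theorem isEtale_splitTarget (hreg : HasRegularFibres π) : IsEtale (SplitTarget π) := by
  have hπ : Continuous π := (IsFactorMap.isProperMap (π := π)).continuous
  have : SecondCountableTopology G' := IsEtale.secondCountable
  have : LocallyCompactSpace G' := IsEtale.locallyCompact
  have : T2Space (SplitTarget π) := t2Space_splitTarget hπ
  have := weaklyLocallyCompactSpace_splitTarget hπ hreg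
  have := sigmaCompactSpace_splitTarget hreg
  have : SecondCountableTopology (SplitTarget π) := EMetric.secondCountable_of_sigmaCompact _
  refine isEtale_of_isInducing SplitTarget.val SplitTarget.val_injective (fun _ => rfl)
    (fun _ => rfl) (fun _ _ _ => rfl) (fun k x hk => ?_) (isInducing_splitTarget_r π)
    (continuous_inv_splitTarget π)
  exact ⟨SplitTarget.mk k ((nontrivial_fiber_r π).mp (hk ▸ x.2)), rfl⟩

/-- Local compactness and σ-compactness are pulled back from `G'_π` along the proper map `splitMap
π`. Saturation holds because an element has a nontrivial fibre exactly when its range does. -/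
theorem isEtale_splitSource (hreg : HasRegularFibres π) : IsEtale (SplitSource π) := by
  have hπ : IsProperMap π := IsFactorMap.isProperMap (π := π)
  have : SecondCountableTopology G' := IsEtale.secondCountable
  have : LocallyCompactSpace G' := IsEtale.locallyCompact
  have := weaklyLocallyCompactSpace_splitTarget hπ.continuous hreg
  have := sigmaCompactSpace_splitTarget hreg
  have hp := isProperMap_splitMap hπ
  have : T2Space (SplitSource π) := t2Space_splitSource
  have : WeaklyLocallyCompactSpace (SplitSource π) := ⟨fun x => by
    obtain ⟨C, hC, hx⟩ := exists_compact_mem_nhds (splitMap π x)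
    exact ⟨_, hp.isCompact_preimage hC, hp.continuous.continuousAt hx⟩⟩
  have : SigmaCompactSpace (SplitSource π) :=
    SigmaCompactSpace_iff_exists_compact_covering.mpr ⟨fun n => splitMap π ⁻¹' compactCovering _ n,
      fun n => hp.isCompact_preimage (isCompact_compactCovering _ n), by
        rw [← Set.preimage_iUnion, iUnion_compactCovering, Set.preimage_univ]⟩
  have : SecondCountableTopology (SplitSource π) := EMetric.secondCountable_of_sigmaCompact _
  refine isEtale_of_isInducing SplitSource.val SplitSource.val_injective (fun _ => rfl)
    (fun _ => rfl) (fun _ _ _ => rfl) (fun k x hk => ?_) (isInducing_splitSource_r π)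
    (continuous_inv_splitSource π)
  refine ⟨SplitSource.mk k ((nontrivial_fiber_r π).mp ?_), rfl⟩
  rw [← IsFactorMap.map_r (π := π), hk]
  exact x.2

/-- The split topology on strings is induced by the underlying string and by its first entry in
`G'_π`; both depend continuously on a string of split elements. -/
theorem continuous_strTarget : (n : ℕ) → Continuous (strTarget π n)
  | 0 => ((fibreBij_pt π).isInducing (isProperMap_strMap π 0)).continuous_iff.mpr
      ((continuous_targetIncl π 0).prodMk continuous_subtype_val)
  | n + 1 => ((fibreBij_arr π n 0).isInducing (isProperMap_strMap π (n + 1))).continuous_iff.mpr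
      ((continuous_targetIncl π (n + 1)).prodMk (continuous_arr n 0))

/-- The inverse of `strTarget`. -/
noncomputable def strTargetInv : (n : ℕ) → SplitTarget (strMap π n) → Str (SplitTarget π) n
  | 0, z => (⟨(fibreBij_pt π).splitTargetMap z, SplitTarget.val_injective z.1.pt.2⟩ :
      UnitSpace (SplitTarget π))
  | n + 1, z => Str.mk (fun k => (fibreBij_arr π n k).splitTargetMap z) fun k =>
      SplitTarget.val_injective (z.1.comp k)

theorem targetIncl_strTargetInv : (n : ℕ) → (z : SplitTarget (strMap π n)) →
    targetIncl π n (strTargetInv π n z) = z.1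
  | 0, _ => rfl
  | _ + 1, _ => rfl

theorem continuous_strTargetInv : (n : ℕ) → Continuous (strTargetInv π n)
  | 0 => ((fibreBij_pt π).continuous_splitTargetMap (isProperMap_strMap π 0)).subtype_mk _
  | n + 1 => by
    rw [(isEmbedding_arr n).continuous_iff, continuous_pi_iff]
    exact fun k => (fibreBij_arr π n k).continuous_splitTargetMap (isProperMap_strMap π (n + 1))

/-- The homeomorphism `(G'_π)⁽ⁿ⁾ → (G'⁽ⁿ⁾)_{π⁽ⁿ⁾}`. -/
noncomputable def strTargetHomeomorph (n : ℕ) :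
    Str (SplitTarget π) n ≃ₜ SplitTarget (strMap π n) where
  toFun := strTarget π n
  invFun := strTargetInv π n
  left_inv z := targetIncl_injective π n (targetIncl_strTargetInv π n (strTarget π n z))
  right_inv z := SplitTarget.val_injective (targetIncl_strTargetInv π n z)
  continuous_toFun := continuous_strTarget π n
  continuous_invFun := continuous_strTargetInv π n

/-- The inverse of `strSource`. -/
noncomputable def strSourceInv : (n : ℕ) → SplitSource (strMap π n) → Str (SplitSource π) n
  | 0, x => (⟨SplitSource.mk x.1.pt.1 ((fibreBij_pt π).splitTargetMap (splitMap _ x)).2,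
      SplitSource.val_injective x.1.pt.2⟩ : UnitSpace (SplitSource π))
  | n + 1, x => Str.mk (fun k => SplitSource.mk (x.1.arr k)
      ((fibreBij_arr π n k).splitTargetMap (splitMap _ x)).2) fun k =>
      SplitSource.val_injective (x.1.comp k)

theorem sourceIncl_strSourceInv : (n : ℕ) → (x : SplitSource (strMap π n)) →
    sourceIncl π n (strSourceInv π n x) = x.1
  | 0, _ => rfl
  | _ + 1, _ => rfl

theorem continuous_strSourceInv : (n : ℕ) → Continuous (strSourceInv π n)
  | 0 => by
    refine Continuous.subtype_mk ?_ _
    rw [isInducing_splitSource.continuous_iff]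
    exact Continuous.prodMk ((continuous_subtype_val (p := fun g : G => r g = g)).comp
      (continuous_splitSource_val (π := strMap π 0)))
      (((fibreBij_pt π).continuous_splitTargetMap (isProperMap_strMap π 0)).comp
        continuous_splitMap)
  | n + 1 => by
    rw [(isEmbedding_arr n).continuous_iff, continuous_pi_iff]
    intro k
    rw [isInducing_splitSource.continuous_iff]
    exact ((continuous_arr n k).comp continuous_splitSource_val).prodMk
      (((fibreBij_arr π n k).continuous_splitTargetMap (isProperMap_strMap π (n + 1))).comp
        continuous_splitMap)

section

variable [IsEtale (SplitSource π)] [IsFactorMap (splitMap π)]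

theorem continuous_strSource (n : ℕ) : Continuous (strSource π n) := by
  rw [isInducing_splitSource.continuous_iff]
  refine (continuous_sourceIncl π n).prodMk ?_
  exact ((continuous_strTarget π n).comp (isProperMap_strMap (splitMap π) n).continuous).congr
    fun x => (splitMap_strSource π n x).symm

/-- The homeomorphism `G_π⁽ⁿ⁾ → (G⁽ⁿ⁾)_{π⁽ⁿ⁾}`. -/
noncomputable def strSourceHomeomorph (n : ℕ) :
    Str (SplitSource π) n ≃ₜ SplitSource (strMap π n) where
  toFun := strSource π n
  invFun := strSourceInv π n
  left_inv z := sourceIncl_injective π n (sourceIncl_strSourceInv π n (strSource π n z))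
  right_inv z := SplitSource.val_injective (sourceIncl_strSourceInv π n z)
  continuous_toFun := continuous_strSource π n
  continuous_invFun := continuous_strSourceInv π n

end

end SplitGroupoids

/-! ### Extension of functions from compact sets, and pull-backs along proper surjections. -/

section Reduction

theorem exists_isCompact_isOpen_between {X : Type*} [TopologicalSpace X] [LocallyCompactSpace X]
    [T2Space X] [TotallyDisconnectedSpace X] {K U : Set X} (hK : IsCompact K) (hU : IsOpen U)
    (hKU : K ⊆ U) : ∃ V, IsCompact V ∧ IsOpen V ∧ K ⊆ V ∧ V ⊆ U := by
  refine hK.induction_on (p := fun S => ∃ V, IsCompact V ∧ IsOpen V ∧ S ⊆ V ∧ V ⊆ U)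
    ⟨∅, isCompact_empty, isOpen_empty, subset_rfl, Set.empty_subset _⟩ ?_ ?_ fun x hx => ?_
  · rintro S T hST ⟨V, h1, h2, h3, h4⟩
    exact ⟨V, h1, h2, hST.trans h3, h4⟩
  · rintro S T ⟨V, h1, h2, h3, h4⟩ ⟨W, k1, k2, k3, k4⟩
    exact ⟨V ∪ W, h1.union k1, h2.union k2, Set.union_subset_union h3 k3, Set.union_subset h4 k4⟩
  · obtain ⟨C, hC, hxC, hCU⟩ := exists_compact_subset hU (hKU hx)
    obtain ⟨V, hV, hxV, hVC⟩ := loc_compact_Haus_tot_disc_of_zero_dim.mem_nhds_iff.mp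
      (isOpen_interior.mem_nhds hxC)
    have hVC := hVC.trans interior_subset
    exact ⟨V, mem_nhdsWithin_of_mem_nhds (hV.2.mem_nhds hxV), V,
      hC.of_isClosed_subset hV.1 hVC, hV.2, subset_rfl, hVC.trans hCU⟩

variable {A : Type*} [AddCommGroup A] [TopologicalSpace A]

/-- A continuous function, cut off outside a compact open set. -/
noncomputable def cutOff {X : Type*} [TopologicalSpace X] [T2Space X] (f : C(X, A)) {V : Set X}
    (hV : IsCompact V) (hV' : IsOpen V) : C_c(X, A) where
  toFun := V.indicator f
  continuous_toFun := by
    classical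
    exact Continuous.piecewise (by simp [IsClopen.frontier_eq ⟨hV.isClosed, hV'⟩])
      f.continuous continuous_const
  hasCompactSupport' := HasCompactSupport.intro hV fun _ hx => Set.indicator_of_notMem hx _

theorem cutOff_of_mem {X : Type*} [TopologicalSpace X] [T2Space X] (f : C(X, A)) {V : Set X}
    (hV : IsCompact V) (hV' : IsOpen V) {x : X} (hx : x ∈ V) : cutOff f hV hV' x = f x :=
  Set.indicator_of_mem hx f

theorem cutOff_of_notMem {X : Type*} [TopologicalSpace X] [T2Space X] (f : C(X, A)) {V : Set X}
    (hV : IsCompact V) (hV' : IsOpen V) {x : X} (hx : x ∉ V) : cutOff f hV hV' x = 0 :=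
  Set.indicator_of_notMem hx f

/-- Induction on the nonzero values allowed on `D`: the level set of `a` in `D` is compact and is
separated, inside `X`, from the image of the rest of `D` by a compact open set. The constant `a` on
that set is added to an extension of the function with the value `a` replaced by `0`. -/
theorem exists_extension_of_finite [DiscreteTopology A] {X Y : Type*} [TopologicalSpace X]
    [LocallyCompactSpace X] [T2Space X] [TotallyDisconnectedSpace X] [TopologicalSpace Y]
    {i : Y → X} (hi : Continuous i) (hinj : Function.Injective i) {D : Set Y} (hD : IsCompact D)
    (T : Finset A) : ∀ F : Y → A, Continuous F → (∀ y ∈ D, F y = 0 ∨ F y ∈ T) →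
      ∃ f : C_c(X, A), ∀ y ∈ D, f (i y) = F y := by
  classical
  induction T using Finset.induction_on with
  | empty =>
    intro F _ hF
    exact ⟨0, fun y hy => ((hF y hy).resolve_right (Finset.notMem_empty _)).symm⟩
  | insert a T _ ih =>
    intro F hFc hF
    have hcl : ∀ S : Set A, IsCompact (D ∩ F ⁻¹' S) := fun S =>
      hD.inter_right ((isClosed_discrete S).preimage hFc)
    obtain ⟨V, hV, hV', hDV, hVD⟩ := exists_isCompact_isOpen_between ((hcl {a}).image hi)
      ((hcl {a}ᶜ).image hi).isClosed.isOpen_compl (by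
        rintro _ ⟨y, ⟨-, hy⟩, rfl⟩ ⟨y', ⟨-, hy'⟩, he⟩
        exact hy' (hinj he ▸ hy))
    obtain ⟨f, hf⟩ := ih (fun y => if F y = a then 0 else F y)
      ((continuous_of_discreteTopology (f := fun b : A => if b = a then 0 else b)).comp hFc)
      fun y hy => by
        by_cases h : F y = a
        · exact Or.inl (if_pos h)
        · simp only [if_neg h]
          exact (hF y hy).imp_right fun h' => (Finset.mem_insert.mp h').resolve_left h
    refine ⟨f + cutOff (ContinuousMap.const X a) hV hV', fun y hy => ?_⟩
    rw [CompactlySupportedContinuousMap.add_apply, hf y hy]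
    by_cases h : F y = a
    · rw [if_pos h, cutOff_of_mem _ hV hV' (hDV ⟨y, ⟨hy, h⟩, rfl⟩), zero_add, h]
      rfl
    · rw [if_neg h, cutOff_of_notMem _ hV hV' fun h' => hVD h' ⟨y, ⟨hy, h⟩, rfl⟩, add_zero]

/-- The extension of a continuous function from a compact set. -/
theorem exists_extension [DiscreteTopology A] {X Y : Type*} [TopologicalSpace X]
    [LocallyCompactSpace X] [T2Space X] [TotallyDisconnectedSpace X] [TopologicalSpace Y]
    {i : Y → X} (hi : Continuous i) (hinj : Function.Injective i) {D : Set Y} (hD : IsCompact D)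
    (F : C_c(Y, A)) : ∃ f : C_c(X, A), ∀ y ∈ D, f (i y) = F y := by
  have hfin : (F '' D).Finite := (hD.image F.continuous).finite_of_discrete
  exact exists_extension_of_finite hi hinj hD hfin.toFinset F F.continuous fun y hy =>
    Or.inr (hfin.mem_toFinset.mpr ⟨y, hy, rfl⟩)

/-- A proper surjection is a quotient map, so a function constant on fibres descends to a continuous
one, which vanishes off the image of the compact support. -/
theorem mem_range_pull_iff {X Y : Type*} [TopologicalSpace X] [TopologicalSpace Y] [T2Space Y]
    [IsTopologicalAddGroup A] {p : X → Y} (hp : IsProperMap p) (hs : Function.Surjective p)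
    (f : C_c(X, A)) : f ∈ (pull (A := A) p hp).range ↔ ∀ a b, p a = p b → f a = f b := by
  constructor
  · rintro ⟨g, rfl⟩ a b hab
    exact congrArg g hab
  · intro h
    have hq : IsQuotientMap p := hp.isClosedMap.isQuotientMap hp.continuous hs
    choose t ht using hs
    have hg : ∀ x, f (t (p x)) = f x := fun x => h _ _ (ht _)
    refine ⟨⟨⟨fun y => f (t y), ?_⟩, ?_⟩, ?_⟩
    · rw [hq.continuous_iff]
      exact f.continuous.congr fun x => (hg x).symm
    · refine HasCompactSupport.intro (f.hasCompactSupport.image hp.continuous) fun y hy => ?_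
      by_contra hne
      exact hy ⟨t y, subset_tsupport _ hne, ht y⟩
    · exact CompactlySupportedContinuousMap.ext hg

/-! ### The reduction map of an abstract split square. -/

variable {X X' Y Y' : Type*} [TopologicalSpace X] [TopologicalSpace X'] [TopologicalSpace Y]
  [TopologicalSpace Y']

/-- The proper map `q : Y → Y'` is the restriction of the proper map `p : X → X'` to the part of
`X'` where the fibres of `p` have more than one point, for finer topologies. -/
structure SplitSquare (p : X → X') (q : Y → Y') (i : Y → X) (j : Y' → X') : Prop where
  isProperMap : IsProperMap p
  isProperMap' : IsProperMap q
  surjective : Function.Surjective p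
  surjective' : Function.Surjective q
  continuous : Continuous i
  continuous' : Continuous j
  injective : Function.Injective i
  injective' : Function.Injective j
  comm : ∀ y, p (i y) = j (q y)
  exists_of_eq : ∀ x y', p x = j y' → ∃ y, i y = x
  exists_of_nontrivial : ∀ x', (p ⁻¹' {x'}).Nontrivial → ∃ y', j y' = x'

/-- `f` is constant on the fibres of `p` over the points of `Y'` outside `K`. -/
def FibreConstOff {X X' Y' A : Type*} (p : X → X') (j : Y' → X') (f : X → A) (K : Set Y') : Prop :=
  ∀ y' ∉ K, ∀ a b, p a = j y' → p b = j y' → f a = f b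

theorem FibreConstOff.mono {X X' Y' A : Type*} {p : X → X'} {j : Y' → X'} {f : X → A} {K L : Set Y'}
    (h : FibreConstOff p j f K) (hKL : K ⊆ L) : FibreConstOff p j f L :=
  fun y' hy => h y' fun hy' => hy (hKL hy')

/-- Every compactly supported continuous function is constant on the fibres outside of a compact
set of split points. -/
def FibreConstAtInfinity (p : X → X') (j : Y' → X') (A : Type*) [AddCommGroup A]
    [TopologicalSpace A] : Prop :=
  ∀ f : C_c(X, A), ∃ L : Set Y', IsCompact L ∧ FibreConstOff p j f L

/-- The prescribed set `C` allows admissible sets for several functions to be nested, and images of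
earlier sets to be absorbed. -/
theorem exists_isCompact_isOpen_fibreConstOff [T2Space Y'] [LocallyCompactSpace Y']
    [TotallyDisconnectedSpace Y'] {p : X → X'} {j : Y' → X'} (hc : FibreConstAtInfinity p j A)
    (f : C_c(X, A)) {C : Set Y'} (hC : IsCompact C) :
    ∃ K : Set Y', IsCompact K ∧ IsOpen K ∧ C ⊆ K ∧ FibreConstOff p j f K := by
  obtain ⟨L, hL, hf⟩ := hc f
  obtain ⟨K, hK, hK', hLK, -⟩ := exists_isCompact_isOpen_between (hL.union hC) isOpen_univ
    (Set.subset_univ _)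
  exact ⟨K, hK, hK', Set.subset_union_right.trans hLK, hf.mono (Set.subset_union_left.trans hLK)⟩

namespace SplitSquare

variable {p : X → X'} {q : Y → Y'} {i : Y → X} {j : Y' → X'} (S : SplitSquare p q i j)

theorem mk_eq_mk_iff [T2Space Y'] [IsTopologicalAddGroup A] (F H : C_c(Y, A)) :
    (QuotientAddGroup.mk F : C_c(Y, A) ⧸ (pull (A := A) q S.isProperMap').range) =
      QuotientAddGroup.mk H ↔ ∀ a b, q a = q b → H a - F a = H b - F b := by
  rw [QuotientAddGroup.eq, mem_range_pull_iff S.isProperMap' S.surjective', neg_add_eq_sub]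
  rfl

variable [T2Space Y] [T2Space Y']

/-- The function `f_K` on `Y`, for `f` on `X` and a compact open set `K ⊆ Y'`. -/
noncomputable def restrict (f : C_c(X, A)) {K : Set Y'} (hK : IsCompact K) (hK' : IsOpen K) :
    C_c(Y, A) :=
  cutOff ⟨fun y => f (i y), f.continuous.comp S.continuous⟩ (S.isProperMap'.isCompact_preimage hK)
    (hK'.preimage S.isProperMap'.continuous)

theorem restrict_of_mem (f : C_c(X, A)) {K : Set Y'} (hK : IsCompact K) (hK' : IsOpen K) {y : Y}
    (hy : q y ∈ K) : S.restrict f hK hK' y = f (i y) :=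
  cutOff_of_mem _ _ _ hy

theorem restrict_of_notMem (f : C_c(X, A)) {K : Set Y'} (hK : IsCompact K) (hK' : IsOpen K) {y : Y}
    (hy : q y ∉ K) : S.restrict f hK hK' y = 0 :=
  cutOff_of_notMem _ _ _ hy

variable [IsTopologicalAddGroup A]

/-- The two truncations differ only over points lying in exactly one of `K` and `L`, and there `f`
is constant on the fibres; hence the difference is a pull-back. -/
theorem mk_restrict_eq (f : C_c(X, A)) {K L : Set Y'} (hK : IsCompact K) (hK' : IsOpen K)
    (hL : IsCompact L) (hL' : IsOpen L) (hfK : FibreConstOff p j f K)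
    (hfL : FibreConstOff p j f L) :
    (QuotientAddGroup.mk (S.restrict f hK hK') :
      C_c(Y, A) ⧸ (pull (A := A) q S.isProperMap').range) =
      QuotientAddGroup.mk (S.restrict f hL hL') := by
  rw [S.mk_eq_mk_iff]
  intro a b hab
  have hb : p (i b) = j (q a) := by rw [hab, S.comm]
  by_cases h1 : q a ∈ K <;> by_cases h2 : q a ∈ L
  · rw [S.restrict_of_mem f hK hK' h1, S.restrict_of_mem f hL hL' h2,
      S.restrict_of_mem f hK hK' (hab ▸ h1), S.restrict_of_mem f hL hL' (hab ▸ h2),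
      sub_self, sub_self]
  · rw [S.restrict_of_mem f hK hK' h1, S.restrict_of_notMem f hL hL' h2,
      S.restrict_of_mem f hK hK' (hab ▸ h1), S.restrict_of_notMem f hL hL' (hab ▸ h2),
      hfL _ h2 _ _ (S.comm a) hb]
  · rw [S.restrict_of_notMem f hK hK' h1, S.restrict_of_mem f hL hL' h2,
      S.restrict_of_notMem f hK hK' (hab ▸ h1), S.restrict_of_mem f hL hL' (hab ▸ h2),
      hfK _ h1 _ _ (S.comm a) hb]
  · rw [S.restrict_of_notMem f hK hK' h1, S.restrict_of_notMem f hL hL' h2,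
      S.restrict_of_notMem f hK hK' (hab ▸ h1), S.restrict_of_notMem f hL hL' (hab ▸ h2)]

variable [LocallyCompactSpace Y'] [TotallyDisconnectedSpace Y'] (hc : FibreConstAtInfinity p j A)

/-- The reduction map. -/
noncomputable def reductionHom :
    C_c(X, A) →+ C_c(Y, A) ⧸ (pull (A := A) q S.isProperMap').range :=
  AddMonoidHom.mk' (fun f => QuotientAddGroup.mk (S.restrict f
    (exists_isCompact_isOpen_fibreConstOff hc f isCompact_empty).choose_spec.1
    (exists_isCompact_isOpen_fibreConstOff hc f isCompact_empty).choose_spec.2.1)) fun f g => by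
      -- Truncation at a fixed set is additive, so the chosen sets for `f`, `g` and `f + g` are all
      -- replaced by one set `K` admissible for the three functions.
      obtain ⟨L, hL, hL', -, hfL⟩ := exists_isCompact_isOpen_fibreConstOff hc f isCompact_empty
      obtain ⟨M, hM, hM', hLM, hgM⟩ := exists_isCompact_isOpen_fibreConstOff hc g hL
      obtain ⟨K, hK, hK', hMK, hK''⟩ := exists_isCompact_isOpen_fibreConstOff hc (f + g) hM
      rw [S.mk_restrict_eq f _ _ hK hK'
          (exists_isCompact_isOpen_fibreConstOff hc f isCompact_empty).choose_spec.2.2.2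
          (hfL.mono (hLM.trans hMK)),
        S.mk_restrict_eq g _ _ hK hK'
          (exists_isCompact_isOpen_fibreConstOff hc g isCompact_empty).choose_spec.2.2.2
          (hgM.mono hMK),
        S.mk_restrict_eq (f + g) _ _ hK hK'
          (exists_isCompact_isOpen_fibreConstOff hc (f + g) isCompact_empty).choose_spec.2.2.2 hK'',
        ← QuotientAddGroup.mk_add]
      congr 1
      ext y
      by_cases hy : q y ∈ K
      · rw [CompactlySupportedContinuousMap.add_apply, S.restrict_of_mem _ hK hK' hy,
          S.restrict_of_mem _ hK hK' hy, S.restrict_of_mem _ hK hK' hy]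
        rfl
      · rw [CompactlySupportedContinuousMap.add_apply, S.restrict_of_notMem _ hK hK' hy,
          S.restrict_of_notMem _ hK hK' hy, S.restrict_of_notMem _ hK hK' hy, add_zero]

theorem reductionHom_eq (f : C_c(X, A)) {K : Set Y'} (hK : IsCompact K) (hK' : IsOpen K)
    (hf : FibreConstOff p j f K) :
    S.reductionHom hc f = QuotientAddGroup.mk (S.restrict f hK hK') :=
  S.mk_restrict_eq f _ _ hK hK'
          (exists_isCompact_isOpen_fibreConstOff hc f isCompact_empty).choose_spec.2.2.2 hf

/-- If the truncation is constant on fibres, then `f` is constant on the fibres over `K`; over the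
other split points it is so by the choice of `K`, and elsewhere the fibres are single points. -/
theorem ker_reductionHom [T2Space X'] :
    (pull (A := A) p S.isProperMap).range = (S.reductionHom hc).ker := by
  ext f
  obtain ⟨K, hK, hK', -, hf⟩ := exists_isCompact_isOpen_fibreConstOff hc f isCompact_empty
  rw [mem_range_pull_iff S.isProperMap S.surjective, AddMonoidHom.mem_ker,
    S.reductionHom_eq hc f hK hK' hf, QuotientAddGroup.eq_zero_iff,
    mem_range_pull_iff S.isProperMap' S.surjective']
  constructor
  · intro h a b hab
    by_cases ha : q a ∈ K
    · rw [S.restrict_of_mem f hK hK' ha, S.restrict_of_mem f hK hK' (hab ▸ ha)]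
      exact h _ _ (by rw [S.comm, S.comm, hab])
    · rw [S.restrict_of_notMem f hK hK' ha, S.restrict_of_notMem f hK hK' (hab ▸ ha)]
  · intro h a b hab
    by_cases hne : a = b
    · rw [hne]
    obtain ⟨y', hy'⟩ := S.exists_of_nontrivial (p a) ⟨a, rfl, b, hab.symm, hne⟩
    obtain ⟨a, rfl⟩ := S.exists_of_eq a y' hy'.symm
    obtain ⟨b, rfl⟩ := S.exists_of_eq b y' (hab.symm.trans hy'.symm)
    rw [S.comm, S.comm] at hab
    have hab := S.injective' hab
    by_cases ha : q a ∈ K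
    · rw [← S.restrict_of_mem f hK hK' ha, ← S.restrict_of_mem f hK hK' (hab ▸ ha)]
      exact h a b hab
    · exact hf (q a) ha _ _ (S.comm a) (by rw [hab, S.comm])

/-- An extension `g` of `F` from the part of `Y` over `K` need not reduce to `F`, since it may vary
on further split fibres. Only those over the compact set `L \ K` matter, and a cut-off pulled back
from `X'` removes them without creating new variation on fibres. -/
theorem surjective_reductionHom [DiscreteTopology A] [LocallyCompactSpace X] [T2Space X]
    [TotallyDisconnectedSpace X] [LocallyCompactSpace X'] [T2Space X']
    [TotallyDisconnectedSpace X'] : Function.Surjective (S.reductionHom hc) := by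
  intro c
  obtain ⟨F, rfl⟩ := QuotientAddGroup.mk_surjective c
  obtain ⟨K, hK, hK', hFK, -⟩ := exists_isCompact_isOpen_between
    (F.hasCompactSupport.image S.isProperMap'.continuous) isOpen_univ (Set.subset_univ _)
  obtain ⟨g, hg⟩ := exists_extension S.continuous S.injective
    (S.isProperMap'.isCompact_preimage hK) F
  obtain ⟨L, hL, hgL⟩ := hc g
  -- As `K` is open, `L \ K` is compact, and injectivity of `j` keeps its image disjoint from that
  -- of `K`.
  obtain ⟨V, hV, hV', hKV, hVL⟩ := exists_isCompact_isOpen_between (hK.image S.continuous')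
    ((hL.diff hK').image S.continuous').isClosed.isOpen_compl (by
      rintro _ ⟨y, hy, rfl⟩ ⟨y', hy', he⟩
      exact hy'.2 (S.injective' he ▸ hy))
  have hpV := S.isProperMap.isCompact_preimage hV
  have hpV' := hV'.preimage S.isProperMap.continuous
  refine ⟨cutOff (g : C(X, A)) hpV hpV', ?_⟩
  rw [S.reductionHom_eq hc _ hK hK' fun y' hy' a b ha hb => ?_]
  · congr 1
    ext y
    by_cases hy : q y ∈ K
    · rw [S.restrict_of_mem _ hK hK' hy, cutOff_of_mem _ hpV hpV' (x := i y)]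
      · exact hg y hy
      · change p (i y) ∈ V
        rw [S.comm]
        exact hKV ⟨q y, hy, rfl⟩
    · rw [S.restrict_of_notMem _ hK hK' hy]
      by_contra hne
      exact hy (hFK ⟨y, subset_tsupport _ (Ne.symm hne), rfl⟩)
  · by_cases hyV : j y' ∈ V
    · rw [cutOff_of_mem _ hpV hpV' (show p a ∈ V from ha ▸ hyV),
        cutOff_of_mem _ hpV hpV' (show p b ∈ V from hb ▸ hyV)]
      exact hgL y' (fun h => hVL hyV ⟨y', ⟨h, hy'⟩, rfl⟩) a b ha hb
    · rw [cutOff_of_notMem _ hpV hpV' (show p a ∉ V from ha ▸ hyV),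
        cutOff_of_notMem _ hpV hpV' (show p b ∉ V from hb ▸ hyV)]

/-- The isomorphism induced by the reduction map. -/
noncomputable def reductionEquiv [DiscreteTopology A] [LocallyCompactSpace X] [T2Space X]
    [TotallyDisconnectedSpace X] [LocallyCompactSpace X'] [T2Space X']
    [TotallyDisconnectedSpace X'] :
    C_c(X, A) ⧸ (pull (A := A) p S.isProperMap).range ≃+
      C_c(Y, A) ⧸ (pull (A := A) q S.isProperMap').range :=
  (QuotientAddGroup.quotientAddEquivOfEq (S.ker_reductionHom hc)).trans
    (QuotientAddGroup.quotientKerEquivOfSurjective _ (S.surjective_reductionHom hc))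

end SplitSquare

/-- The reduction maps are compatible with the push-forward along local homeomorphisms which are
bijective on the respective fibres. -/
theorem SplitSquare.mk_push_restrict [DiscreteTopology A] {X₁ X₁' Y₁ Y₁' : Type*}
    [TopologicalSpace X₁] [TopologicalSpace X₁'] [TopologicalSpace Y₁] [TopologicalSpace Y₁']
    [T2Space X] [T2Space Y] [T2Space Y'] [T2Space X₁] [T2Space Y₁] [T2Space Y₁']
    {p : X → X'} {q : Y → Y'} {i : Y → X} {j : Y' → X'} (S : SplitSquare p q i j)
    {p₁ : X₁ → X₁'} {q₁ : Y₁ → Y₁'} {i₁ : Y₁ → X₁} {j₁ : Y₁' → X₁'} (S₁ : SplitSquare p₁ q₁ i₁ j₁)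
    {d : X₁ → X} {e : Y₁ → Y} {e' : Y₁' → Y'} (hd : IsLocalHomeomorph d)
    (he : IsLocalHomeomorph e) (hde : ∀ y, Set.BijOn i₁ (e ⁻¹' {y}) (d ⁻¹' {i y}))
    (hee : ∀ y, Set.BijOn q₁ (e ⁻¹' {y}) (e' ⁻¹' {q y})) (f : C_c(X₁, A))
    {K₁ : Set Y₁'} (hK₁ : IsCompact K₁) (hK₁' : IsOpen K₁) (hf : FibreConstOff p₁ j₁ f K₁)
    {K : Set Y'} (hK : IsCompact K) (hK' : IsOpen K) (hKK : e' '' K₁ ⊆ K) :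
    (QuotientAddGroup.mk (push e he (S₁.restrict f hK₁ hK₁')) :
      C_c(Y, A) ⧸ (pull (A := A) q S.isProperMap').range) =
      QuotientAddGroup.mk (S.restrict (push d hd f) hK hK') := by
  classical
  rw [S.mk_eq_mk_iff]
  -- `f ∘ i₁` need not have compact support for the finer topology of `Y₁`; finiteness of the sums
  -- comes from `f` on `X₁`.
  have hfin : ∀ y, (e ⁻¹' {y} ∩ Function.support fun y₁ => f (i₁ y₁)).Finite := fun y =>
    ((finite_fiber_support hd f (i y)).preimage (S₁.injective.injOn (s := Set.univ.preimage i₁)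
      |>.mono (Set.subset_univ _))).subset fun y₁ hy₁ => ⟨(hde y).mapsTo hy₁.1, hy₁.2⟩
  -- Outside `K₁` the function `f ∘ i₁` is constant on the fibres of `q₁`, so `g` is its descent
  -- there, independent of the chosen preimage. It is set to `0` on `K₁`, so that it records exactly
  -- what truncation discards.
  let g : Y₁' → A := fun z => if h : z ∉ K₁ ∧ ∃ y₁, q₁ y₁ = z then f (i₁ h.2.choose) else 0
  have hg : ∀ y₁, g (q₁ y₁) = if q₁ y₁ ∈ K₁ then 0 else f (i₁ y₁) := by
    intro y₁
    by_cases h : q₁ y₁ ∈ K₁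
    · rw [if_pos h]
      exact dif_neg fun h' => h'.1 h
    · rw [if_neg h]
      have h' : q₁ y₁ ∉ K₁ ∧ ∃ y₂, q₁ y₂ = q₁ y₁ := ⟨h, y₁, rfl⟩
      refine (dif_pos h').trans (hf _ h _ _ ?_ (S₁.comm y₁))
      rw [S₁.comm, h'.2.choose_spec]
  -- The bijection `i₁` turns the sum over a fibre of `d` into one over a fibre of `e`, and `q₁`
  -- turns the discarded part into a sum over a fibre of `e'`. The latter depends on `q y` alone.
  have hsum : ∀ y, q y ∈ K → S.restrict (push d hd f) hK hK' y -
      push e he (S₁.restrict f hK₁ hK₁') y = ∑ᶠ z ∈ e' ⁻¹' {q y}, g z := by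
    intro y hy
    rw [S.restrict_of_mem _ hK hK' hy, push_apply, push_apply, sub_eq_iff_eq_add,
      ← finsum_mem_eq_of_bijOn (f := fun y₁ => f (i₁ y₁)) i₁ (hde y) fun _ _ => rfl,
      ← finsum_mem_eq_of_bijOn (f := fun y₁ => g (q₁ y₁)) q₁ (hee y) fun _ _ => rfl,
      ← finsum_mem_add_distrib']
    · refine finsum_mem_congr rfl fun y₁ _ => ?_
      rw [hg]
      by_cases h : q₁ y₁ ∈ K₁
      · rw [if_pos h, S₁.restrict_of_mem f hK₁ hK₁' h, zero_add]
      · rw [if_neg h, S₁.restrict_of_notMem f hK₁ hK₁' h, add_zero]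
    · refine (hfin y).subset fun y₁ hy₁ => ⟨hy₁.1, fun h0 => hy₁.2 ?_⟩
      simp only [hg, h0, ite_self]
    · refine (hfin y).subset fun y₁ hy₁ => ⟨hy₁.1, fun h0 => hy₁.2 ?_⟩
      have h0 : f (i₁ y₁) = 0 := h0
      by_cases h : q₁ y₁ ∈ K₁
      · rw [S₁.restrict_of_mem f hK₁ hK₁' h, h0]
      · rw [S₁.restrict_of_notMem f hK₁ hK₁' h]
  -- Here `e' '' K₁ ⊆ K` is used: no point over `K₁` contributes to the push-forward at `y`.
  have hzero : ∀ y, q y ∉ K → S.restrict (push d hd f) hK hK' y -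
      push e he (S₁.restrict f hK₁ hK₁') y = 0 := by
    intro y hy
    rw [S.restrict_of_notMem _ hK hK' hy, push_apply, zero_sub, neg_eq_zero]
    refine finsum_mem_eq_zero_of_forall_eq_zero fun y₁ hy₁ => ?_
    refine S₁.restrict_of_notMem f hK₁ hK₁' fun h => hy ?_
    have : e' (q₁ y₁) = q y := (hee y).mapsTo hy₁
    rw [← this]
    exact hKK ⟨_, h, rfl⟩
  intro a b hab
  by_cases h : q a ∈ K
  · rw [hsum a h, hsum b (hab ▸ h), hab]
  · rw [hzero a h, hzero b (hab ▸ h)]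

end Reduction

/-! ### Application to the nerves, and the chain isomorphism. -/

section Conclusion

open GroupoidStr

theorem totallyDisconnectedSpace_of_injective {X Y : Type*} [TopologicalSpace X]
    [TopologicalSpace Y] [TotallyDisconnectedSpace Y] {f : X → Y} (hf : Continuous f)
    (hi : Function.Injective f) : TotallyDisconnectedSpace X :=
  ⟨isTotallyDisconnected_of_image hf.continuousOn hi
    (isTotallyDisconnected_of_totallyDisconnectedSpace _)⟩

theorem locallyCompactSpace_str {G : Type*} [GroupoidStr G] [TopologicalSpace G] [IsEtale G] :
    (n : ℕ) → LocallyCompactSpace (Str G n)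
  | 0 => by
    have : T2Space G := IsEtale.hausdorff
    have : LocallyCompactSpace G := IsEtale.locallyCompact
    exact IsClosedEmbedding.locallyCompactSpace
      (isClosed_eq continuous_r continuous_id).isClosedEmbedding_subtypeVal
  | n + 1 => by
    have : LocallyCompactSpace G := IsEtale.locallyCompact
    exact (isClosedEmbedding_arr n).locallyCompactSpace

theorem totallyDisconnectedSpace_str {G : Type*} [GroupoidStr G] [TopologicalSpace G]
    [TotallyDisconnectedSpace G] : (n : ℕ) → TotallyDisconnectedSpace (Str G n)
  | 0 => inferInstanceAs (TotallyDisconnectedSpace {x : G // r x = x})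
  | n + 1 => totallyDisconnectedSpace_of_injective (isEmbedding_arr n).continuous
      (isEmbedding_arr n).injective

/-- Take a Lebesgue number `ε` of the support for the cover by level sets, which are open as `A` is
discrete. A fibre of diameter below `ε` that meets the support lies in one level set; the remaining
split fibres meeting the support lie over a compact set. -/
theorem HasRegularFibres.fibreConstAtInfinity {X X' : Type*} [PseudoEMetricSpace X]
    [TopologicalSpace X'] [T2Space X'] {π : X → X'} (hreg : HasRegularFibres π)
    (hπ : Continuous π) (A : Type*) [AddCommGroup A] [TopologicalSpace A] [DiscreteTopology A] :
    FibreConstAtInfinity π (SplitTarget.val (π := π)) A := by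
  intro f
  obtain ⟨ε, hε, h⟩ := lebesgue_number_lemma_of_emetric (c := fun a : A => f ⁻¹' {a})
    f.hasCompactSupport (fun a => (isOpen_discrete {a}).preimage f.continuous)
    fun x _ => Set.mem_iUnion.mpr ⟨f x, rfl⟩
  have hloc : ∀ a ∈ tsupport f, ∀ b, edist b a < ε → f a = f b := by
    intro a ha b hab
    obtain ⟨c, hc⟩ := h a ha
    exact Eq.trans (hc (Metric.mem_eball_self hε)) (Eq.symm (hc hab))
  refine ⟨_, isCompact_splitTarget hreg (f.hasCompactSupport.image hπ) hε,
    fun y hy a b ha hb => ?_⟩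
  -- One of the two points in the support suffices, as its `ε`-ball is contained in a level set; two
  -- points off the support both have value `0`.
  have key : ∀ a b, π a = y.1 → π b = y.1 → a ∈ tsupport f → f a = f b := by
    intro a b ha hb has
    refine hloc a has b (lt_of_le_of_lt (Metric.edist_le_ediam_of_mem (s := π ⁻¹' {y.1}) hb ha) ?_)
    by_contra hlt
    exact hy ⟨not_lt.mp hlt, a, has, ha⟩
  by_cases has : a ∈ tsupport f
  · exact key a b ha hb has
  by_cases hbs : b ∈ tsupport f
  · exact (key b a hb ha hbs).symm
  · rw [image_eq_zero_of_notMem_tsupport has, image_eq_zero_of_notMem_tsupport hbs]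

variable {G G' : Type u} [GroupoidStr G] [GroupoidStr G']

section

variable [TopologicalSpace G] [TopologicalSpace G'] (π : G → G') [IsFactorMap π]

theorem strMap_surjective (n : ℕ) : Function.Surjective (strMap π n) := by
  intro z
  obtain ⟨x, hx⟩ := IsFactorMap.surjective (π := π) (firstVertex n z).1
  obtain ⟨g, hg, -⟩ := exists_strMap_eq_of_firstVertex π n z
    ⟨x, eq_r_of_map_unit π (by rw [hx, (firstVertex n z).2])⟩ (Subtype.ext hx)
  exact ⟨g, hg⟩

theorem shortExact_relSequence [IsEtale G] [IsEtale G'] (A : Type w) [AddCommGroup A]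
    [TopologicalSpace A] [IsTopologicalAddGroup A] : (relSequence π A).ShortExact := by
  refine HomologicalComplex.shortExact_of_degreewise_shortExact _ fun n => ?_
  refine ShortComplex.ShortExact.mk' ?_ ?_ ?_
  · rw [ShortComplex.ab_exact_iff_range_eq_ker]
    exact (QuotientAddGroup.ker_mk' (strPull π A n).range).symm
  · rw [AddCommGrpCat.mono_iff_injective]
    intro f g hfg
    refine CompactlySupportedContinuousMap.ext fun y => ?_
    obtain ⟨x, rfl⟩ := strMap_surjective π n y
    exact congrArg (fun k : C_c(Str G n, A) => k x) hfg
  · rw [AddCommGrpCat.epi_iff_surjective]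
    exact QuotientAddGroup.mk_surjective (s := (strPull π A n).range)

theorem sourceIncl_face : (n : ℕ) → (i : Fin (n + 2)) → (g : Str (SplitSource π) (n + 1)) →
    sourceIncl π n (face n i g) = face n i (sourceIncl π (n + 1) g)
  | 0, i, g => by
    by_cases h : i = 0
    · subst h; rfl
    · have h1 : face 0 i g = rangeUnit (g.arr 0) := if_neg h
      have h2 : face 0 i (sourceIncl π 1 g) = rangeUnit ((sourceIncl π 1 g).arr 0) := if_neg h
      rw [h1, h2]
      rfl
  | n + 1, i, g => Str.ext fun k => by
    change ((face (n + 1) i g).arr k).1 = _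
    rcases lt_trichotomy ((k : ℕ) + 1) i with h | h | h
    · rw [face_arr_of_lt _ h, face_arr_of_lt _ h]; rfl
    · rw [face_arr_of_eq _ h, face_arr_of_eq _ h]; rfl
    · rw [face_arr_of_gt _ h, face_arr_of_gt _ h]; rfl

end

variable [MetricSpace G] [MetricSpace G'] [IsEtale G] [IsEtale G'] (π : G → G') [IsFactorMap π]

theorem exists_sourceIncl_eq (n : ℕ) (x : Str G n)
    (h : (strMap π n ⁻¹' {strMap π n x}).Nontrivial) : ∃ y, sourceIncl π n y = x :=
  ⟨_, sourceIncl_strSourceInv π n (SplitSource.mk x h)⟩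

/-- The content is surjectivity: a string with a split face is itself split, so a face map has no
further preimages in `G` than in `G_π`. -/
theorem bijOn_sourceIncl_face (n : ℕ) (i : Fin (n + 2)) (y : Str (SplitSource π) n) :
    Set.BijOn (sourceIncl π (n + 1)) (face n i ⁻¹' {y}) (face n i ⁻¹' {sourceIncl π n y}) := by
  refine ⟨fun g hg => ?_, (sourceIncl_injective π (n + 1)).injOn, fun x hx => ?_⟩
  · have hg : face n i g = y := hg
    change face n i (sourceIncl π (n + 1) g) = _
    rw [← sourceIncl_face, hg]
  · have hx : face n i x = sourceIncl π n y := hx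
    have hnt : (strMap π (n + 1) ⁻¹' {strMap π (n + 1) x}).Nontrivial := by
      -- `π⁽ⁿ⁺¹⁾` is bijective on fibres of the face map, so each lift of the face of `strMap π (n +
      -- 1) x` extends to a lift of the whole string; distinct faces give distinct lifts.
      have hlift : ∀ a, strMap π n a = strMap π n (sourceIncl π n y) →
          ∃ b, strMap π (n + 1) b = strMap π (n + 1) x ∧ face n i b = a := by
        intro a ha
        obtain ⟨b, hb, hbx⟩ := (bijOn_strMap_face π n i a).surjOn
          (show face n i (strMap π (n + 1) x) = strMap π n a by rw [← strMap_face, hx, ha])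
        exact ⟨b, hbx, hb⟩
      obtain ⟨a, ha, b, hb, hab⟩ := nontrivial_fiber_sourceIncl π n y
      obtain ⟨a', ha', rfl⟩ := hlift a ha
      obtain ⟨b', hb', rfl⟩ := hlift b hb
      exact ⟨a', ha', b', hb', fun h => hab (by rw [h])⟩
    obtain ⟨g, rfl⟩ := exists_sourceIncl_eq π (n + 1) x hnt
    rw [← sourceIncl_face] at hx
    exact ⟨g, sourceIncl_injective π n hx, rfl⟩

theorem fibreConstAtInfinity_strMap (hreg : HasRegularFibres π) (A : Type w) [AddCommGroup A]
    [TopologicalSpace A] [DiscreteTopology A] (n : ℕ) :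
    FibreConstAtInfinity (strMap π n) (targetIncl π n) A := by
  intro f
  obtain ⟨L, hL, hf⟩ := (hasRegularFibres_strMap π hreg n).fibreConstAtInfinity
    (isProperMap_strMap π n).continuous A f
  exact ⟨strTarget π n ⁻¹' L, (strTargetHomeomorph π n).isCompact_preimage.mpr hL,
    fun y hy a b ha hb => hf (strTarget π n y) hy a b ha hb⟩

variable [IsEtale (SplitSource π)] [IsFactorMap (splitMap π)]

theorem splitSquare_strMap (n : ℕ) : SplitSquare (strMap π n) (strMap (splitMap π) n)
    (sourceIncl π n) (targetIncl π n) where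
  isProperMap := isProperMap_strMap π n
  isProperMap' := isProperMap_strMap (splitMap π) n
  surjective := strMap_surjective π n
  surjective' := strMap_surjective (splitMap π) n
  continuous := continuous_sourceIncl π n
  continuous' := continuous_targetIncl π n
  injective := sourceIncl_injective π n
  injective' := targetIncl_injective π n
  comm := strMap_sourceIncl π n
  exists_of_eq x y' h := exists_sourceIncl_eq π n x (h ▸ nontrivial_fiber_targetIncl π n y')
  exists_of_nontrivial z h := ⟨_, targetIncl_strTargetInv π n (SplitTarget.mk z h)⟩

end Conclusion

end EtaleFactor

theorem proposition4p16 {G G' : Type u}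
    [MetricSpace G] [GroupoidStr G] [IsEtale G] [TotallyDisconnectedSpace G]
    [MetricSpace G'] [GroupoidStr G'] [IsEtale G'] [TotallyDisconnectedSpace G']
    (π : G → G') [IsFactorMap π] (hreg : IsRegularMap π)
    (A : Type w) [AddCommGroup A] [TopologicalSpace A] [DiscreteTopology A] :
    ∃ (_ : IsEtale (SplitSource π)) (_ : IsEtale (SplitTarget π)) (_ : IsFactorMap (splitMap π)),
      (∀ n, IsHomeomorph (strSource π n) ∧ IsHomeomorph (strTarget π n)) ∧
      ∃ red : ∀ n, RelGroup π A n ≃+ RelGroup (splitMap π) A n,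
        (∀ n (f : C_c(Str G n, A)), IsReduction π n f (red n (QuotientAddGroup.mk f))) ∧
        (∃ Φ : relComplex π A ≅ relComplex (splitMap π) A,
          ∀ n, Φ.hom.f n = AddCommGrpCat.ofHom (red n).toAddMonoidHom) ∧
        (relSequence π A).ShortExact ∧ (relSequence (splitMap π) A).ShortExact := by
  have hreg' : HasRegularFibres π :=
    hreg.hasRegularFibres (IsFactorMap.isProperMap (π := π)) (IsFactorMap.surjective (π := π))
  have hS := isEtale_splitSource π hreg'
  have hT := isEtale_splitTarget π hreg'
  have hF := isFactorMap_splitMap π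
  refine ⟨hS, hT, hF, fun n => ⟨(strSourceHomeomorph π n).isHomeomorph,
    (strTargetHomeomorph π n).isHomeomorph⟩, ?_⟩
  have : TotallyDisconnectedSpace (SplitTarget π) := totallyDisconnectedSpace_of_injective
    (continuous_splitTarget_val (IsFactorMap.isProperMap (π := π)).continuous)
    SplitTarget.val_injective
  have (n : ℕ) : LocallyCompactSpace (Str G n) := locallyCompactSpace_str n
  have (n : ℕ) : LocallyCompactSpace (Str G' n) := locallyCompactSpace_str n
  have (n : ℕ) : LocallyCompactSpace (Str (SplitTarget π) n) := locallyCompactSpace_str n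
  have (n : ℕ) : TotallyDisconnectedSpace (Str G n) := totallyDisconnectedSpace_str n
  have (n : ℕ) : TotallyDisconnectedSpace (Str G' n) := totallyDisconnectedSpace_str n
  have (n : ℕ) : TotallyDisconnectedSpace (Str (SplitTarget π) n) := totallyDisconnectedSpace_str n
  have hsq := splitSquare_strMap π
  have hc := fibreConstAtInfinity_strMap π hreg' A
  let red : ∀ n, RelGroup π A n ≃+ RelGroup (splitMap π) A n := fun n =>
    (hsq n).reductionEquiv (hc n)
  have hred : ∀ n (f : C_c(Str G n, A)) {K : Set (Str (SplitTarget π) n)} (hK : IsCompact K)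
      (hK' : IsOpen K), FibreConstOff (strMap π n) (targetIncl π n) f K →
      red n (QuotientAddGroup.mk f) = QuotientAddGroup.mk ((hsq n).restrict f hK hK') :=
    fun n f _ hK hK' hf => (hsq n).reductionHom_eq (hc n) f hK hK' hf
  have hface : ∀ n (i : Fin (n + 2)) (f : C_c(Str G (n + 1), A))
      {K : Set (Str (SplitTarget π) (n + 1))} (hK : IsCompact K) (hK' : IsOpen K),
      FibreConstOff (strMap π (n + 1)) (targetIncl π (n + 1)) f K →
      (QuotientAddGroup.mk (facePush (SplitSource π) A n i ((hsq (n + 1)).restrict f hK hK')) :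
        RelGroup (splitMap π) A n) = red n (QuotientAddGroup.mk (facePush G A n i f)) := by
    intro n i f K hK hK' hf
    -- `L` must be admissible for the push-forward and contain the face of `K`. It may depend on
    -- `i`, because the reduced class does not depend on the admissible set.
    obtain ⟨L, hL, hL', hKL, hfL⟩ := exists_isCompact_isOpen_fibreConstOff (hc n)
      (facePush G A n i f) (hK.image (continuous_face n i))
    rw [hred n _ hL hL' hfL]
    exact (hsq n).mk_push_restrict (hsq (n + 1)) (isLocalHomeomorph_face n i)
      (isLocalHomeomorph_face n i) (bijOn_sourceIncl_face π n i)
      (bijOn_strMap_face (splitMap π) n i) f hK hK' hf hL hL' hKL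
  have hcomm : ∀ n (c : RelGroup π A (n + 1)),
      relBoundary (splitMap π) A n (red (n + 1) c) = red n (relBoundary π A n c) := by
    intro n c
    obtain ⟨f, rfl⟩ := QuotientAddGroup.mk_surjective c
    obtain ⟨K, hK, hK', -, hf⟩ := exists_isCompact_isOpen_fibreConstOff (hc (n + 1)) f
      isCompact_empty
    rw [hred (n + 1) f hK hK' hf]
    change QuotientAddGroup.mk' (strPull (splitMap π) A n).range (boundary _ A n _) =
      red n (QuotientAddGroup.mk' (strPull π A n).range (boundary G A n f))
    simp only [boundary_apply, map_sum, map_zsmul]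
    exact Finset.sum_congr rfl fun i _ => congrArg _ (hface n i f hK hK' hf)
  refine ⟨red, fun n f => ?_, ⟨HomologicalComplex.Hom.isoOfComponents
    (fun n => (red n).toAddCommGrpIso) ?_, fun n => rfl⟩, shortExact_relSequence π A,
    shortExact_relSequence (splitMap π) A⟩
  · obtain ⟨K, hK, hK', -, hf⟩ := exists_isCompact_isOpen_fibreConstOff (hc n) f isCompact_empty
    -- Any admissible `K` serves as the threshold once moved to the split strings: larger compact
    -- open sets stay admissible and give the same class.
    refine ⟨strTarget π n '' K, hK.image (continuous_strTarget π n),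
      (strTargetHomeomorph π n).isOpenMap _ hK', fun M hM hM' hKM => ?_⟩
    have hN := (strTargetHomeomorph π n).isCompact_preimage.mpr hM
    have hN' := hM'.preimage (continuous_strTarget π n)
    refine ⟨(hsq n).restrict f hN hN', fun x => ?_, (hred n f hN hN'
      (hf.mono (Set.image_subset_iff.mp hKM))).symm⟩
    by_cases hx : strMap (splitMap π) n x ∈ strTarget π n ⁻¹' M
    · rw [(hsq n).restrict_of_mem f hN hN' hx, truncate, if_pos]
      · rfl
      · rwa [splitMap_strSource]
    · rw [(hsq n).restrict_of_notMem f hN hN' hx, truncate, if_neg]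
      rwa [splitMap_strSource]
  · rintro _ n rfl
    rw [relComplex_d, relComplex_d]
    exact AddCommGrpCat.hom_ext (AddMonoidHom.ext fun c => hcomm n c)
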